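/- Let $M$ be a finite-dimensional smooth manifold with a smooth free action $m:\mathbb R_{>0}\times M\to M$, let $P_x=\frac{d}{dt}\big|_{t=0}m(e^t,x)$ be the vector field generated by it, let $g$ be a pseudo-Riemannian metric on $M$ (a smooth field of nondegenerate symmetric bilinear forms), let $f:M\to\mathbb R_{>0}$ be smooth and let $\alpha\in\mathbb R\setminus\{0,1\}$. Suppose that $(g,f)$ is a homogeneous pair of degree $\alpha$, i.e. $m_\lambda^*g=\lambda^\alpha g$ and $m_\lambda^*f=\lambda^\alpha f$ for all $\lambda>0$, where $m_\lambda=m(\lambda,\cdot)$, and $g(P,\cdot)=df$. Put $$\hat g=\frac{df\otimes df}{f}+(1-\alpha)\,g .$$ Suppose that $g$ is flat (its Riemann curvature tensor vanishes). A metric is said to have constant sectional curvature $C$ if every tangent plane on which it is nondegenerate has sectional curvature $C$. Then the following holds. 1. Suppose $\alpha<1$. (a) For all $C,C_2\in\mathbb R$ with $\alpha C>0$, set $$v(r)=\frac{\alpha}{4(1-\alpha)\,C\,r\,\Big(\cosh\big(\tfrac{1}{2\sqrt{1-\alpha}}(\log r+C_2)\big)\Big)^2}\qquad(r>0).$$ Then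 $(v\circ f)\,\hat g$ is a pseudo-Riemannian metric on $M$ of constant sectional curvature $C$. (b) For both choices of the sign, $f^{-1\pm\frac{1}{\sqrt{1-\alpha}}}\,\hat g$ is a flat pseudo-Riemannian metric on $M$. 2. Suppose $\alpha>1$. For all $C<0$ and $C_2\in\mathbb R$, set $$v(r)=\frac{\alpha}{4(1-\alpha)\,C\,r\,\Big(\sin\big(\tfrac{1}{2\sqrt{\alpha-1}}(\log r+C_2)\big)\Big)^2}.$$ Then $(v\circ f)\,\hat g$ is a pseudo-Riemannian metric of constant sectional curvature $C$ on the open set $$M\setminus\bigcup_{N\in\mathbb Z}f^{-1}\Big(\exp\big(2N\pi\sqrt{\alpha-1}-C_2\big)\Big).$$ -/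

import Mathlib

open scoped Manifold ContDiff Bundle

noncomputable section

namespace HomogPair

variable {E : Type*} [NormedAddCommGroup E] [NormedSpace ℝ E]
  {M : Type*} [TopologicalSpace M] [ChartedSpace E M]

variable (E M) in
/-- Fields of bilinear forms on the tangent spaces of `M`, i.e. (not necessarily smooth) sections
of `T*M ⊗ T*M`. -/
abbrev BilinField : Type _ :=
  ∀ x : M, TangentSpace 𝓘(ℝ, E) x →L[ℝ] TangentSpace 𝓘(ℝ, E) x →L[ℝ] ℝ

/-- `g` is a (smooth) pseudo-Riemannian metric on the subset `U` of `M`; it is used for open `U`.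
Nothing is required of `g` outside `U`. -/
structure IsPseudoRiemannianOn [IsManifold 𝓘(ℝ, E) ∞ M] (g : BilinField E M) (U : Set M) :
    Prop where
  smooth : ContMDiffOn 𝓘(ℝ, E) (𝓘(ℝ, E).prod 𝓘(ℝ, E →L[ℝ] E →L[ℝ] ℝ)) ∞
    (fun x ↦ Bundle.TotalSpace.mk' (E →L[ℝ] E →L[ℝ] ℝ)
      (E := fun x ↦ TangentSpace 𝓘(ℝ, E) x →L[ℝ] TangentSpace 𝓘(ℝ, E) x →L[ℝ] ℝ) x (g x)) U
  symm : ∀ x ∈ U, ∀ u v, g x u v = g x v u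
  nondegenerate : ∀ x ∈ U, ∀ u, (∀ v, g x u v = 0) → u = 0

/-! ### Christoffel symbols and curvature of a metric on an open subset of a vector space -/

/-- The covector `w ↦ (D_u G)(v, w) + (D_v G)(u, w) - (D_w G)(u, v)` at `y`, for a field `G` of
bilinear forms on `E`. -/
def koszulForm (G : E → E →L[ℝ] E →L[ℝ] ℝ) (y u v : E) : E →L[ℝ] ℝ :=
  fderiv ℝ G y u v + fderiv ℝ G y v u - ((fderiv ℝ G y).flip u).flip v

/-- The Christoffel symbols `Γ_y(u, v) = ∇_u v` (for constant vector fields `u`, `v`) of the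
Levi-Civita connection of `G`: for nondegenerate `G y` it is the vector with
`2 G_y(Γ_y(u, v), w) = (D_u G)(v, w) + (D_v G)(u, w) - (D_w G)(u, v)` for all `w`. -/
def christoffel (G : E → E →L[ℝ] E →L[ℝ] ℝ) (y u v : E) : E :=
  (1 / 2 : ℝ) • (G y).inverse (koszulForm G y u v)

/-- The curvature tensor `R(u, v) w = ∇_u ∇_v w - ∇_v ∇_u w` of `G` at `y`, for constant vector
fields `u`, `v`, `w`. -/
def localCurvature (G : E → E →L[ℝ] E →L[ℝ] ℝ) (y u v w : E) : E :=
  fderiv ℝ (fun z ↦ christoffel G z v w) y u - fderiv ℝ (fun z ↦ christoffel G z u w) y v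
    + christoffel G y u (christoffel G y v w) - christoffel G y v (christoffel G y u w)

/-! ### Curvature of a pseudo-Riemannian metric on a manifold -/

/-- The pullback `(φ⁻¹)^* g` of `g` under the inverse of the chart `φ` at `x`: its value at `y` is
`(u, v) ↦ g(dφ⁻¹ u, dφ⁻¹ v)`, the derivative `D = dφ⁻¹` being taken at `y` and `B` being `g` at
`φ⁻¹(y)`. (Both tangent spaces are the model space `E` by definition.) -/
def metricInChart (g : BilinField E M) (x : M) (y : E) : E →L[ℝ] E →L[ℝ] ℝ :=
  let D : E →L[ℝ] E :=
    mfderiv 𝓘(ℝ, E) 𝓘(ℝ, E) (extChartAt 𝓘(ℝ, E) x).symm y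
  let B : E →L[ℝ] E →L[ℝ] ℝ := g ((extChartAt 𝓘(ℝ, E) x).symm y)
  B.bilinearComp D D

/-- The curvature tensor `R^g(A, B) = [∇_A, ∇_B] - ∇_{[A, B]}` at `x`, computed in the chart `φ`
at `x` and transported back to the tangent space at `x`. -/
def curvature (g : BilinField E M) (x : M) (a b c : TangentSpace 𝓘(ℝ, E) x) :
    TangentSpace 𝓘(ℝ, E) x :=
  let D : TangentSpace 𝓘(ℝ, E) x →L[ℝ] E :=
    mfderiv 𝓘(ℝ, E) 𝓘(ℝ, E) (extChartAt 𝓘(ℝ, E) x) x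
  D.inverse (localCurvature (metricInChart g x) (extChartAt 𝓘(ℝ, E) x x) (D a) (D b) (D c))

/-- `g` is flat on `U`: its curvature tensor vanishes there. -/
def IsFlatOn (g : BilinField E M) (U : Set M) : Prop :=
  ∀ x ∈ U, ∀ a b c : TangentSpace 𝓘(ℝ, E) x, curvature g x a b c = 0

/-- The sectional curvature `K^g(a, b)` of the plane spanned by `a` and `b`; it is meaningful when
`g` is nondegenerate on that plane, i.e. when the denominator does not vanish. -/
def sectionalCurvature (g : BilinField E M) (x : M) (a b : TangentSpace 𝓘(ℝ, E) x) : ℝ :=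
  g x (curvature g x a b b) a / (g x a a * g x b b - g x a b ^ 2)

/-- `g` has constant sectional curvature `C` on `U`: `K^g = C` for every nondegenerate tangent
plane at a point of `U`. (A nonzero Gram determinant makes `a` and `b` linearly independent.) -/
def HasConstSectionalCurvatureOn (g : BilinField E M) (U : Set M) (C : ℝ) : Prop :=
  ∀ x ∈ U, ∀ a b : TangentSpace 𝓘(ℝ, E) x,
    g x a a * g x b b - g x a b ^ 2 ≠ 0 → sectionalCurvature g x a b = C

/-! ### Homogeneous pairs -/

variable (E) in
/-- `m` restricts to a smooth free action of the multiplicative group of positive reals on `M`.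
The values `m r` for `r ≤ 0` play no role. -/
structure IsFreePosAction (m : ℝ → M → M) : Prop where
  one : ∀ x, m 1 x = x
  mul : ∀ r s, 0 < r → 0 < s → ∀ x, m (r * s) x = m r (m s x)
  free : ∀ r, 0 < r → ∀ x, m r x = x → r = 1
  smooth : ContMDiffOn (𝓘(ℝ, ℝ).prod 𝓘(ℝ, E)) 𝓘(ℝ, E) ∞ (fun p : ℝ × M ↦ m p.1 p.2)
    (Set.Ioi (0 : ℝ) ×ˢ Set.univ)

variable (E) in
/-- The vector field `P_x = d/dt m(e^t, x) |_{t = 0}` generated by the action. The derivative is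
taken at the point `m(e^0, x)`, which is `x` for an action. -/
def generator (m : ℝ → M → M) (x : M) : TangentSpace 𝓘(ℝ, E) x :=
  (mfderiv 𝓘(ℝ, ℝ) 𝓘(ℝ, E) (fun t : ℝ ↦ m (Real.exp t) x) 0 (1 : ℝ) : E)

/-- `(g, f)` is a homogeneous pair of degree `α` on `M`, for the free action `m` of the positive
reals. -/
structure IsHomogeneousPair [IsManifold 𝓘(ℝ, E) ∞ M] (m : ℝ → M → M) (g : BilinField E M)
    (f : M → ℝ) (α : ℝ) : Prop where
  action : IsFreePosAction E m
  metric : IsPseudoRiemannianOn g Set.univ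
  smooth : ContMDiff 𝓘(ℝ, E) 𝓘(ℝ, ℝ) ∞ f
  pos : ∀ x, 0 < f x
  degree_ne_zero : α ≠ 0
  homog_metric : ∀ r, 0 < r → ∀ (x : M) (u v : TangentSpace 𝓘(ℝ, E) x),
    g (m r x) (mfderiv 𝓘(ℝ, E) 𝓘(ℝ, E) (m r) x u) (mfderiv 𝓘(ℝ, E) 𝓘(ℝ, E) (m r) x v)
      = r ^ α * g x u v
  homog_fun : ∀ r, 0 < r → ∀ x, f (m r x) = r ^ α * f x
  grad : ∀ x, g x (generator E m x) = mvfderiv 𝓘(ℝ, E) f x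

/-- `ĝ = (df ⊗ df) / f + (1 - α) g`. -/
def hatMetric (g : BilinField E M) (f : M → ℝ) (α : ℝ) : BilinField E M := fun x ↦
  (f x)⁻¹ • (mvfderiv 𝓘(ℝ, E) f x).smulRight (mvfderiv 𝓘(ℝ, E) f x) + (1 - α) • g x

/-- The conformal change `(v ∘ f) g`. -/
def conformal (v : ℝ → ℝ) (f : M → ℝ) (g : BilinField E M) : BilinField E M := fun x ↦
  v (f x) • g x

end HomogPair

end

namespace HomogPair

open Filter Topology

noncomputable section

/-! ### Levi-Civita connection and curvature on a vector space. -/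

section LocalGeometry

variable {E : Type*} [NormedAddCommGroup E] [NormedSpace ℝ E]

-- Near a point, read the metric, the function and the generator in a chart as G, F and P. Since
-- G(P, ·) = dF is closed, ∇P is self-adjoint, while homogeneity gives 𝓛_P G = αG. Together these
-- force ∇P = (α/2) Id and Hess F = (α/2) G (`fderiv_field_of_localPair`, `hessian_of_localPair`),
-- so covariant derivatives of dF and P are again algebraic in G.
--
-- Hence the Levi-Civita connection of H = v(F) Ĝ differs from that of G by a tensor built from dF,
-- G, P and functions of F (`christoffel_localHat`). Differentiating once more, if R^G = 0 then
-- R^H(u, x)w = C (H(x, w)u − H(u, w)x), provided that v solves the equations of `IsProfileAt`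
-- (`localCurvature_localHat`). This covers both constant curvature and, for C = 0, flatness.
--
-- With s = r (log(r v))', the equations are s' = −2Cv/α and α(1 − (1 − α)s²) = 4rC(1 − α)v. The
-- difference of the two sides of the second is constant along solutions of the first, so `energy`
-- only fixes an integration constant. Eliminating v leaves the Riccati equation r s' = −(1 − (1 −
-- α)s²)/(2(1 − α)); its tanh, cot and constant solutions yield the cosh, sine and power factors.

local instance : NormedAddCommGroup (E →L[ℝ] ℝ) := ContinuousLinearMap.toNormedAddCommGroup

local instance : NormedSpace ℝ (E →L[ℝ] ℝ) := ContinuousLinearMap.toNormedSpace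

local instance : NormedAddCommGroup (E →L[ℝ] E →L[ℝ] ℝ) :=
  ContinuousLinearMap.toNormedAddCommGroup

local instance : NormedSpace ℝ (E →L[ℝ] E →L[ℝ] ℝ) := ContinuousLinearMap.toNormedSpace

/-- In finite dimension, injectivity into the dual is bijectivity. This is what makes `christoffel`
meaningful, since `ContinuousLinearMap.inverse` takes the default value 0 on non-invertible maps. -/
lemma isInvertible_of_nondegenerate [FiniteDimensional ℝ E] (B : E →L[ℝ] E →L[ℝ] ℝ)
    (hB : ∀ u, (∀ v, B u v = 0) → u = 0) : B.IsInvertible := by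
  have hinj : Function.Injective (B : E →ₗ[ℝ] E →L[ℝ] ℝ) := by
    rw [← LinearMap.ker_eq_bot, LinearMap.ker_eq_bot']
    intro u hu
    exact hB u fun v ↦ by simpa using DFunLike.congr_fun hu v
  have hrank : Module.finrank ℝ E = Module.finrank ℝ (E →L[ℝ] ℝ) := by
    rw [← (LinearMap.toContinuousLinearMap (𝕜 := ℝ) (E := E) (F' := ℝ)).finrank_eq]
    exact (Subspace.dual_finrank_eq (K := ℝ) (V := E)).symm
  let e := (LinearEquiv.ofInjectiveOfFinrankEq _ hinj hrank).toContinuousLinearEquiv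
  refine ⟨e, ?_⟩
  ext u v
  rfl

section Christoffel

variable {G : E → E →L[ℝ] E →L[ℝ] ℝ} {y : E}

lemma koszulForm_apply (G : E → E →L[ℝ] E →L[ℝ] ℝ) (y u v w : E) :
    koszulForm G y u v w = fderiv ℝ G y u v w + fderiv ℝ G y v u w - fderiv ℝ G y w u v := by
  simp [koszulForm]

lemma apply_christoffel (hG : (G y).IsInvertible) (u v w : E) :
    G y (christoffel G y u v) w = 1 / 2 *
      (fderiv ℝ G y u v w + fderiv ℝ G y v u w - fderiv ℝ G y w u v) := by
  rw [christoffel, map_smul, hG.self_apply_inverse, smul_apply, koszulForm_apply,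
    smul_eq_mul]

/-- Uniqueness in the Koszul formula: a guessed connection can be verified by pairing it with
arbitrary vectors, without inverting the metric. -/
lemma christoffel_eq_of_apply (hG : (G y).IsInvertible) {u v X : E}
    (h : ∀ w, G y X w = 1 / 2 *
      (fderiv ℝ G y u v w + fderiv ℝ G y v u w - fderiv ℝ G y w u v)) :
    christoffel G y u v = X := by
  apply hG.injective
  ext w
  rw [apply_christoffel hG, h]

lemma christoffel_add_right (G : E → E →L[ℝ] E →L[ℝ] ℝ) (y u v v' : E) :
    christoffel G y u (v + v') = christoffel G y u v + christoffel G y u v' := by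
  simp only [christoffel]
  rw [← smul_add, ← ContinuousLinearMap.map_add]
  congr 2
  ext w
  simp only [koszulForm_apply, ContinuousLinearMap.map_add, add_apply]
  ring

lemma christoffel_smul_right (G : E → E →L[ℝ] E →L[ℝ] ℝ) (y : E) (c : ℝ) (u v : E) :
    christoffel G y u (c • v) = c • christoffel G y u v := by
  simp only [christoffel]
  rw [smul_comm c]
  congr 1
  rw [← ContinuousLinearMap.map_smul]
  congr 1
  ext w
  simp only [koszulForm_apply, ContinuousLinearMap.map_smul, smul_apply, smul_eq_mul]
  ring

lemma fderiv_symm_of_eventually (hd : DifferentiableAt ℝ G y)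
    (hs : ∀ᶠ z in 𝓝 y, ∀ u v, G z u v = G z v u) (u v w : E) :
    fderiv ℝ G y u v w = fderiv ℝ G y u w v := by
  have h1 : (fun z ↦ G z v w) =ᶠ[𝓝 y] fun z ↦ G z w v := hs.mono fun z hz ↦ hz v w
  have h2 (a b : E) : HasFDerivAt (fun z ↦ G z a b) (((fderiv ℝ G y).flip a).flip b) y := by
    exact ((ContinuousLinearMap.apply ℝ ℝ b).comp
      (ContinuousLinearMap.apply ℝ (E →L[ℝ] ℝ) a)).hasFDerivAt.comp y hd.hasFDerivAt
  have h3 := ((h2 w v).congr_of_eventuallyEq h1).unique (h2 v w)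
  simpa using (DFunLike.congr_fun h3 u).symm

lemma christoffel_comm (hd : DifferentiableAt ℝ G y)
    (hs : ∀ᶠ z in 𝓝 y, ∀ u v, G z u v = G z v u) (u v : E) :
    christoffel G y u v = christoffel G y v u := by
  simp only [christoffel]
  congr 2
  ext w
  rw [koszulForm_apply, koszulForm_apply, fderiv_symm_of_eventually hd hs w u v]
  ring

/-- The Levi-Civita connection is compatible with the metric. -/
lemma fderiv_metric_apply (hG : (G y).IsInvertible) (hd : DifferentiableAt ℝ G y)
    (hs : ∀ᶠ z in 𝓝 y, ∀ u v, G z u v = G z v u) (u v w : E) :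
    fderiv ℝ G y u v w = G y (christoffel G y u v) w + G y v (christoffel G y u w) := by
  rw [hs.self_of_nhds v, apply_christoffel hG, apply_christoffel hG,
    fderiv_symm_of_eventually hd hs u w v, fderiv_symm_of_eventually hd hs v u w,
    fderiv_symm_of_eventually hd hs w u v]
  ring

lemma differentiableAt_christoffel [CompleteSpace E] (hG : (G y).IsInvertible)
    (hd : ContDiffAt ℝ 2 G y) (u v : E) :
    DifferentiableAt ℝ (fun z ↦ christoffel G z u v) y := by
  have h1 : DifferentiableAt ℝ (fderiv ℝ G) y :=
    (hd.fderiv_right (m := 1) (by norm_num)).differentiableAt (by norm_num)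
  have h2 : DifferentiableAt ℝ (fun z ↦ (G z).inverse) y :=
    ((hG.contDiffAt_map_inverse (n := 1)).differentiableAt (by norm_num)).comp y
      (hd.differentiableAt (by norm_num))
  have h3 : DifferentiableAt ℝ (fun z ↦ koszulForm G z u v) y := by
    have h4 : DifferentiableAt ℝ (fun z ↦ ((fderiv ℝ G z).flip u).flip v) y := by
      have : DifferentiableAt ℝ (fun z ↦ (fderiv ℝ G z).flip u) y :=
        ((ContinuousLinearMap.flipₗᵢ ℝ E E (E →L[ℝ] ℝ)).differentiableAt.comp y h1).clm_apply
          (differentiableAt_const u)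
      exact ((ContinuousLinearMap.flipₗᵢ ℝ E E ℝ).differentiableAt.comp y this).clm_apply
          (differentiableAt_const v)
    unfold koszulForm
    fun_prop
  exact (h2.clm_apply h3).const_smul (1 / 2 : ℝ)

end Christoffel

/-- The chart expression near `y` of a homogeneous pair: the metric `G`, the function `F` and the
generating vector field `P`, with the identities `G(P, ·) = dF`, `P F = α F` and
`𝓛_P G = α G`. -/
structure IsLocalPairAt (G : E → E →L[ℝ] E →L[ℝ] ℝ) (F : E → ℝ) (P : E → E) (α : ℝ) (y : E) :
    Prop where
  contDiffAt_metric : ContDiffAt ℝ 2 G y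
  contDiffAt_fun : ContDiffAt ℝ 2 F y
  contDiffAt_field : ContDiffAt ℝ 1 P y
  symm : ∀ u v, G y u v = G y v u
  nondegenerate : ∀ u, (∀ v, G y u v = 0) → u = 0
  pos : 0 < F y
  grad : ∀ v, G y (P y) v = fderiv ℝ F y v
  euler : fderiv ℝ F y (P y) = α * F y
  lie : ∀ u v, fderiv ℝ G y (P y) u v + G y (fderiv ℝ P y u) v + G y u (fderiv ℝ P y v)
    = α * G y u v

/-! ### Covariant derivatives of the generating field and of the function. -/

section LocalPair

variable {G : E → E →L[ℝ] E →L[ℝ] ℝ} {F : E → ℝ} {P : E → E} {α : ℝ} {y : E}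

lemma IsLocalPairAt.isInvertible [FiniteDimensional ℝ E] (h : IsLocalPairAt G F P α y) :
    (G y).IsInvertible :=
  isInvertible_of_nondegenerate _ h.nondegenerate

lemma IsLocalPairAt.differentiableAt_metric (h : IsLocalPairAt G F P α y) :
    DifferentiableAt ℝ G y :=
  h.contDiffAt_metric.differentiableAt (by norm_num)

lemma fderiv_fderiv_of_localPair (h : ∀ᶠ z in 𝓝 y, IsLocalPairAt G F P α z) (u w : E) :
    fderiv ℝ (fderiv ℝ F) y u w = fderiv ℝ G y u (P y) w + G y (fderiv ℝ P y u) w := by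
  have hy := h.self_of_nhds
  have h1 : fderiv ℝ F =ᶠ[𝓝 y] fun z ↦ G z (P z) := h.mono fun z hz ↦ by
    ext v; exact (hz.grad v).symm
  have h2 := hy.differentiableAt_metric.hasFDerivAt.clm_apply
    (hy.contDiffAt_field.differentiableAt (by norm_num)).hasFDerivAt
  rw [h1.fderiv_eq, h2.fderiv]
  simp [add_comm]

/-- The covariant derivative of the generating field `P` is `(α / 2) Id`. -/
lemma fderiv_field_of_localPair [FiniteDimensional ℝ E]
    (h : ∀ᶠ z in 𝓝 y, IsLocalPairAt G F P α z) (u : E) :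
    fderiv ℝ P y u = (α / 2) • u - christoffel G y u (P y) := by
  have hy := h.self_of_nhds
  have hs : ∀ᶠ z in 𝓝 y, ∀ u v, G z u v = G z v u := h.mono fun z hz ↦ hz.symm
  apply hy.isInvertible.injective
  ext w
  -- As dF = G(P, ·), symmetry of the second derivative makes G(∇_u P, w) symmetric in u and w. The
  -- identity `lie` says that G(∇_u P, w) + G(u, ∇_w P) = αG(u, w), so each summand is half of the
  -- right-hand side.
  have hsymm : fderiv ℝ (fderiv ℝ F) y u w = fderiv ℝ (fderiv ℝ F) y w u :=
    (hy.contDiffAt_fun.isSymmSndFDerivAt (by simp)).eq u w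
  rw [fderiv_fderiv_of_localPair h, fderiv_fderiv_of_localPair h] at hsymm
  have hl := hy.lie u w
  have e1 := hy.symm u (fderiv ℝ P y w)
  have e2 := fderiv_symm_of_eventually hy.differentiableAt_metric hs w u (P y)
  rw [map_sub, map_smul, sub_apply, smul_apply,
    apply_christoffel hy.isInvertible, smul_eq_mul]
  linarith

/-- The Hessian of `F` is `(α / 2) G`. -/
lemma hessian_of_localPair [FiniteDimensional ℝ E]
    (h : ∀ᶠ z in 𝓝 y, IsLocalPairAt G F P α z) (u w : E) :
    fderiv ℝ (fderiv ℝ F) y u w = α / 2 * G y u w + fderiv ℝ F y (christoffel G y u w) := by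
  have hy := h.self_of_nhds
  have hs : ∀ᶠ z in 𝓝 y, ∀ u v, G z u v = G z v u := h.mono fun z hz ↦ hz.symm
  rw [fderiv_fderiv_of_localPair h, fderiv_field_of_localPair h,
    fderiv_metric_apply hy.isInvertible hy.differentiableAt_metric hs, ← hy.grad]
  simp only [map_sub, map_smul, sub_apply, smul_apply,
    smul_eq_mul]
  ring

end LocalPair

/-! ### The conformally changed metric on a vector space. -/

/-- The bilinear form `c (φ ⊗ φ / r + (1 - α) B)`. -/
def hatForm (c r α : ℝ) (φ : E →L[ℝ] ℝ) (B : E →L[ℝ] E →L[ℝ] ℝ) : E →L[ℝ] E →L[ℝ] ℝ :=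
  c • (r⁻¹ • φ.smulRight φ + (1 - α) • B)

lemma hatForm_apply (c r α : ℝ) (φ : E →L[ℝ] ℝ) (B : E →L[ℝ] E →L[ℝ] ℝ) (u w : E) :
    hatForm c r α φ B u w = c * (r⁻¹ * (φ u * φ w) + (1 - α) * B u w) := by
  simp [hatForm]
  ring

lemma hatForm_nondegenerate {c r α : ℝ} {φ : E →L[ℝ] ℝ} {B : E →L[ℝ] E →L[ℝ] ℝ} {p : E}
    (hc : c ≠ 0) (hr : r ≠ 0) (hα : α ≠ 1) (hs : ∀ u v, B u v = B v u) (hp : ∀ v, B p v = φ v)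
    (hφ : φ p = α * r) (hB : ∀ u, (∀ v, B u v = 0) → u = 0) (u : E)
    (hu : ∀ v, hatForm c r α φ B u v = 0) : u = 0 := by
  have h1 : 1 - α ≠ 0 := sub_ne_zero.2 hα.symm
  -- Pairing with p collapses the form: c(αφ(u) + (1 − α)φ(u)) = cφ(u). Once φ(u) = 0, only the
  -- multiple c(1 − α) of B remains.
  have h2 : φ u = 0 := by
    have := hu p
    rw [hatForm_apply, hφ, hs u p, hp] at this
    field_simp at this
    have h : c * φ u = 0 := by linarith
    exact (mul_eq_zero.1 h).resolve_left hc
  refine hB u fun w ↦ ?_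
  have := hu w
  rw [hatForm_apply, h2] at this
  simpa [hc, h1] using this

/-- The differential equations satisfied at `r` by a conformal factor `v` for which
`v(f) ĝ` has constant curvature `C`; here `s = r (log (r v))'`. -/
structure IsProfileAt (α C : ℝ) (v s : ℝ → ℝ) (r : ℝ) : Prop where
  ne_zero : v r ≠ 0
  hasDerivAt : HasDerivAt v (v r * (s r - 1) / r) r
  hasDerivAt_slope : HasDerivAt s (-(2 * C * v r / α)) r
  energy : α * (1 - (1 - α) * s r ^ 2) = 4 * r * C * (1 - α) * v r

/-- The chart expression of the conformal change `v(F) Ĝ`. -/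
def localHat (v : ℝ → ℝ) (α : ℝ) (G : E → E →L[ℝ] E →L[ℝ] ℝ) (F : E → ℝ) (z : E) :
    E →L[ℝ] E →L[ℝ] ℝ :=
  hatForm (v (F z)) (F z) α (fderiv ℝ F z) (G z)

variable {G : E → E →L[ℝ] E →L[ℝ] ℝ} {F : E → ℝ} {P : E → E} {α C : ℝ} {v s : ℝ → ℝ} {y : E}

/-- Differentiation along t ↦ y + tu reduces the later computations to product and quotient rules in
one real variable. -/
lemma hasDerivAt_line {X : Type*} [NormedAddCommGroup X] [NormedSpace ℝ X] {k : E → X}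
    (hk : DifferentiableAt ℝ k y) (u : E) :
    HasDerivAt (fun t : ℝ ↦ k (y + t • u)) (fderiv ℝ k y u) 0 :=
  hk.hasFDerivAt.hasLineDerivAt u

lemma IsLocalPairAt.hasDerivAt_line_fun (h : IsLocalPairAt G F P α y) (u : E) :
    HasDerivAt (fun t : ℝ ↦ F (y + t • u)) (fderiv ℝ F y u) 0 :=
  hasDerivAt_line (h.contDiffAt_fun.differentiableAt (by norm_num)) u

lemma hasDerivAt_line_fderiv_fun [FiniteDimensional ℝ E]
    (h : ∀ᶠ z in 𝓝 y, IsLocalPairAt G F P α z) (u w : E) :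
    HasDerivAt (fun t : ℝ ↦ fderiv ℝ F (y + t • u) w)
      (α / 2 * G y u w + fderiv ℝ F y (christoffel G y u w)) 0 := by
  have h1 : DifferentiableAt ℝ (fderiv ℝ F) y :=
    (h.self_of_nhds.contDiffAt_fun.fderiv_right (m := 1) (by norm_num)).differentiableAt
      (by norm_num)
  rw [← hessian_of_localPair h]
  exact (ContinuousLinearMap.apply ℝ ℝ w).hasFDerivAt.comp_hasDerivAt 0 (hasDerivAt_line h1 u)

lemma hasDerivAt_line_apply (hd : DifferentiableAt ℝ G y) (u v w : E) :
    HasDerivAt (fun t : ℝ ↦ G (y + t • u) v w) (fderiv ℝ G y u v w) 0 :=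
  ((ContinuousLinearMap.apply ℝ ℝ w).comp
    (ContinuousLinearMap.apply ℝ (E →L[ℝ] ℝ) v)).hasFDerivAt.comp_hasDerivAt 0
      (hasDerivAt_line hd u)

lemma hasDerivAt_line_metric [FiniteDimensional ℝ E]
    (h : ∀ᶠ z in 𝓝 y, IsLocalPairAt G F P α z) (u v w : E) :
    HasDerivAt (fun t : ℝ ↦ G (y + t • u) v w)
      (G y (christoffel G y u v) w + G y v (christoffel G y u w)) 0 := by
  have hy := h.self_of_nhds
  rw [← fderiv_metric_apply hy.isInvertible hy.differentiableAt_metric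
    (h.mono fun z hz ↦ hz.symm)]
  exact hasDerivAt_line_apply hy.differentiableAt_metric u v w

lemma hasDerivAt_line_field [FiniteDimensional ℝ E]
    (h : ∀ᶠ z in 𝓝 y, IsLocalPairAt G F P α z) (u : E) :
    HasDerivAt (fun t : ℝ ↦ P (y + t • u)) ((α / 2) • u - christoffel G y u (P y)) 0 := by
  rw [← fderiv_field_of_localPair h]
  exact hasDerivAt_line (h.self_of_nhds.contDiffAt_field.differentiableAt (by norm_num)) u

lemma IsLocalPairAt.hasDerivAt_line_comp (h : IsLocalPairAt G F P α y) {k : ℝ → ℝ} {k' : ℝ}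
    (hk : HasDerivAt k k' (F y)) (u : E) :
    HasDerivAt (fun t : ℝ ↦ k (F (y + t • u))) (k' * fderiv ℝ F y u) 0 :=
  hk.comp_of_eq 0 (h.hasDerivAt_line_fun u) (by simp)

lemma differentiableAt_localHat (h : IsLocalPairAt G F P α y) (hv : DifferentiableAt ℝ v (F y)) :
    DifferentiableAt ℝ (localHat v α G F) y := by
  have hF : DifferentiableAt ℝ F y := h.contDiffAt_fun.differentiableAt (by norm_num)
  have h1 : DifferentiableAt ℝ (fderiv ℝ F) y :=
    (h.contDiffAt_fun.fderiv_right (m := 1) (by norm_num)).differentiableAt (by norm_num)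
  have h2 : DifferentiableAt ℝ (fun z ↦ (fderiv ℝ F z).smulRight (fderiv ℝ F z)) y :=
    ((ContinuousLinearMap.smulRightL ℝ E (E →L[ℝ] ℝ)).differentiableAt.comp y h1).clm_apply h1
  have h3 : DifferentiableAt ℝ (fun z ↦ (F z)⁻¹) y := hF.fun_inv h.pos.ne'
  exact (hv.comp y hF).smul ((h3.smul h2).add (h.differentiableAt_metric.const_smul (1 - α)))

lemma isInvertible_localHat [FiniteDimensional ℝ E] (h : IsLocalPairAt G F P α y) (hα : α ≠ 1)
    (hv : v (F y) ≠ 0) : (localHat v α G F y).IsInvertible :=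
  isInvertible_of_nondegenerate _ (hatForm_nondegenerate hv h.pos.ne' hα h.symm h.grad h.euler
    h.nondegenerate)

/-- The product rule, with D²F and DG rewritten through the Christoffel symbols of G. In the Koszul
formula for the new metric the derivatives then cancel down to G, dF and these symbols. -/
lemma fderiv_localHat_apply [FiniteDimensional ℝ E] {v' : ℝ}
    (h : ∀ᶠ z in 𝓝 y, IsLocalPairAt G F P α z) (hv : HasDerivAt v v' (F y)) (u x w : E) :
    fderiv ℝ (localHat v α G F) y u x w =
      v' * fderiv ℝ F y u *
        ((F y)⁻¹ * (fderiv ℝ F y x * fderiv ℝ F y w) + (1 - α) * G y x w)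
      + v (F y) * (-(fderiv ℝ F y u) / F y ^ 2 * (fderiv ℝ F y x * fderiv ℝ F y w)
        + (F y)⁻¹ * ((α / 2 * G y u x + fderiv ℝ F y (christoffel G y u x)) * fderiv ℝ F y w
          + fderiv ℝ F y x * (α / 2 * G y u w + fderiv ℝ F y (christoffel G y u w)))
        + (1 - α) * (G y (christoffel G y u x) w + G y x (christoffel G y u w))) := by
  have hy := h.self_of_nhds
  have h1 := hasDerivAt_line_apply (differentiableAt_localHat hy hv.differentiableAt) u x w
  have h2 := (hy.hasDerivAt_line_comp hv u).fun_mul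
      ((((hy.hasDerivAt_line_fun u).fun_inv (by simpa using hy.pos.ne')).fun_mul
        ((hasDerivAt_line_fderiv_fun h u x).fun_mul (hasDerivAt_line_fderiv_fun h u w))).fun_add
        ((hasDerivAt_line_metric h u x w).const_mul (1 - α)))
  simp only [localHat, hatForm_apply] at h1
  have h3 := h1.unique h2
  simp only [zero_smul, add_zero] at h3
  exact h3

/-- The Levi-Civita connection of `v(F) Ĝ`, in terms of that of `G`. -/
lemma christoffel_localHat [FiniteDimensional ℝ E] (hα : α ≠ 1)
    (h : ∀ᶠ z in 𝓝 y, IsLocalPairAt G F P α z) (hv : IsProfileAt α C v s (F y)) (x w : E) :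
    christoffel (localHat v α G F) y x w = christoffel G y x w
      + ((s (F y) - 1) / (2 * F y)) • (fderiv ℝ F y x • w + fderiv ℝ F y w • x)
      + ((1 - (1 - α) * s (F y)) / (2 * F y) * G y x w
        - s (F y) / (2 * F y ^ 2) * (fderiv ℝ F y x * fderiv ℝ F y w)) • P y := by
  have hy := h.self_of_nhds
  have hF : F y ≠ 0 := hy.pos.ne'
  have hs : ∀ᶠ z in 𝓝 y, ∀ u v, G z u v = G z v u := h.mono fun z hz ↦ hz.symm
  apply christoffel_eq_of_apply (isInvertible_localHat hy hα hv.ne_zero)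
  intro z
  simp only [fderiv_localHat_apply h hv.hasDerivAt]
  have c1 := christoffel_comm hy.differentiableAt_metric hs w x
  have c2 := christoffel_comm hy.differentiableAt_metric hs z x
  have c3 := christoffel_comm hy.differentiableAt_metric hs z w
  have e1 := hy.symm w x
  have e2 := hy.symm z x
  have e3 := hy.symm z w
  have e4 := hy.symm (christoffel G y x z) w
  simp only [localHat, hatForm_apply, map_add, map_smul, add_apply, smul_apply, smul_eq_mul,
    hy.grad, hy.euler, c1, c2, c3, e1, e2, e3, e4]
  field_simp
  ring

/-- The derivative along `u` of the Christoffel symbols of `v(F) Ĝ`. -/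
lemma fderiv_christoffel_localHat [FiniteDimensional ℝ E] (hα : α ≠ 1)
    (h : ∀ᶠ z in 𝓝 y, IsLocalPairAt G F P α z) (hv : ∀ᶠ r in 𝓝 (F y), IsProfileAt α C v s r)
    (u x w : E) :
    fderiv ℝ (fun z ↦ christoffel (localHat v α G F) z x w) y u =
      fderiv ℝ (fun z ↦ christoffel G z x w) y u
      + (((-(2 * C * v (F y) / α) / (2 * F y) - (s (F y) - 1) / (2 * F y ^ 2)) * fderiv ℝ F y u) •
          (fderiv ℝ F y x • w + fderiv ℝ F y w • x)
        + ((s (F y) - 1) / (2 * F y)) •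
          ((α / 2 * G y u x + fderiv ℝ F y (christoffel G y u x)) • w
            + (α / 2 * G y u w + fderiv ℝ F y (christoffel G y u w)) • x))
      + ((((1 - α) * (2 * C * v (F y) / α) / (2 * F y)
              - (1 - (1 - α) * s (F y)) / (2 * F y ^ 2)) * fderiv ℝ F y u * G y x w
            + (1 - (1 - α) * s (F y)) / (2 * F y)
              * (G y (christoffel G y u x) w + G y x (christoffel G y u w))
            + ((2 * C * v (F y) / α) / (2 * F y ^ 2) + s (F y) / F y ^ 3) * fderiv ℝ F y u
              * (fderiv ℝ F y x * fderiv ℝ F y w)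
            - s (F y) / (2 * F y ^ 2)
              * ((α / 2 * G y u x + fderiv ℝ F y (christoffel G y u x)) * fderiv ℝ F y w
                + fderiv ℝ F y x * (α / 2 * G y u w + fderiv ℝ F y (christoffel G y u w)))) • P y
        + ((1 - (1 - α) * s (F y)) / (2 * F y) * G y x w
          - s (F y) / (2 * F y ^ 2) * (fderiv ℝ F y x * fderiv ℝ F y w)) •
            ((α / 2) • u - christoffel G y u (P y))) := by
  have : CompleteSpace E := FiniteDimensional.complete ℝ E
  have hy := h.self_of_nhds
  have hF : F y ≠ 0 := hy.pos.ne'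
  have hFc : ContinuousAt F y := hy.contDiffAt_fun.continuousAt
  have hvy := hv.self_of_nhds
  -- The formula for the new connection is to be differentiated, so it is needed near y. This is why
  -- both the pair identities and the profile equations are assumed on neighbourhoods.
  have ev : (fun z ↦ christoffel (localHat v α G F) z x w) =ᶠ[𝓝 y] fun z ↦
      christoffel G z x w
      + ((s (F z) - 1) / (2 * F z)) • (fderiv ℝ F z x • w + fderiv ℝ F z w • x)
      + ((1 - (1 - α) * s (F z)) / (2 * F z) * G z x w
        - s (F z) / (2 * F z ^ 2) * (fderiv ℝ F z x * fderiv ℝ F z w)) • P z := by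
    filter_upwards [h.eventually_nhds, hFc.eventually hv] with z hz hvz
    exact christoffel_localHat hα hz hvz x w
  have hG := differentiableAt_christoffel hy.isInvertible hy.contDiffAt_metric x w
  have hs := hvy.hasDerivAt_slope
  have hid : HasDerivAt (fun r : ℝ ↦ 2 * r) (2 * 1) (F y) := (hasDerivAt_id (F y)).const_mul 2
  have hsq : HasDerivAt (fun r : ℝ ↦ 2 * r ^ 2) (2 * (2 * F y)) (F y) := by
    simpa using (hasDerivAt_pow 2 (F y)).const_mul 2
  -- The slope equation s' = −2Cv/α removes all derivatives of v and s from the derivatives of the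
  -- three coefficients.
  have ha : HasDerivAt (fun r ↦ (s r - 1) / (2 * r))
      (-(2 * C * v (F y) / α) / (2 * F y) - (s (F y) - 1) / (2 * F y ^ 2)) (F y) := by
    convert! (hs.sub_const 1).fun_div hid (by simpa using hF) using 1
    field_simp
  have hb : HasDerivAt (fun r ↦ (1 - (1 - α) * s r) / (2 * r))
      ((1 - α) * (2 * C * v (F y) / α) / (2 * F y)
        - (1 - (1 - α) * s (F y)) / (2 * F y ^ 2)) (F y) := by
    convert! ((hs.const_mul (1 - α)).const_sub 1).fun_div hid (by simpa using hF) using 1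
    field_simp
  have hc : HasDerivAt (fun r ↦ s r / (2 * r ^ 2))
      (-((2 * C * v (F y) / α) / (2 * F y ^ 2) + s (F y) / F y ^ 3)) (F y) := by
    convert! hs.fun_div hsq (by simpa using hF) using 1
    field_simp
    ring
  have h1 := (hy.hasDerivAt_line_comp ha u).fun_smul
    (((hasDerivAt_line_fderiv_fun h u x).smul_const w).fun_add
      ((hasDerivAt_line_fderiv_fun h u w).smul_const x))
  have h2 := (((hy.hasDerivAt_line_comp hb u).fun_mul (hasDerivAt_line_metric h u x w)).fun_sub
    ((hy.hasDerivAt_line_comp hc u).fun_mul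
      ((hasDerivAt_line_fderiv_fun h u x).fun_mul (hasDerivAt_line_fderiv_fun h u w)))).fun_smul
    (hasDerivAt_line_field h u)
  have h3 := ((hasDerivAt_line hG u).fun_add h1).fun_add h2
  -- The derivative along a line only determines `fderiv` once differentiability at y is known.
  have hd : DifferentiableAt ℝ (fun z ↦
      christoffel G z x w
      + ((s (F z) - 1) / (2 * F z)) • (fderiv ℝ F z x • w + fderiv ℝ F z w • x)
      + ((1 - (1 - α) * s (F z)) / (2 * F z) * G z x w
        - s (F z) / (2 * F z ^ 2) * (fderiv ℝ F z x * fderiv ℝ F z w)) • P z) y := by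
    have hFd : DifferentiableAt ℝ F y := hy.contDiffAt_fun.differentiableAt (by norm_num)
    have hF1 : DifferentiableAt ℝ (fderiv ℝ F) y :=
      (hy.contDiffAt_fun.fderiv_right (m := 1) (by norm_num)).differentiableAt (by norm_num)
    have hF2 (a : E) : DifferentiableAt ℝ (fun z ↦ fderiv ℝ F z a) y :=
      hF1.clm_apply (differentiableAt_const a)
    have hGd : DifferentiableAt ℝ (fun z ↦ G z x w) y :=
      (hy.differentiableAt_metric.clm_apply (differentiableAt_const x)).clm_apply
        (differentiableAt_const w)
    have hP : DifferentiableAt ℝ P y := hy.contDiffAt_field.differentiableAt (by norm_num)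
    exact (hG.fun_add ((ha.differentiableAt.comp y hFd).fun_smul
      (((hF2 x).smul_const w).fun_add ((hF2 w).smul_const x)))).fun_add
      ((((hb.differentiableAt.comp y hFd).fun_mul hGd).fun_sub
        ((hc.differentiableAt.comp y hFd).fun_mul ((hF2 x).fun_mul (hF2 w)))).fun_smul hP)
  rw [ev.fderiv_eq]
  have h4 := (hasDerivAt_line hd u).unique h3
  simp only [zero_smul, add_zero] at h4
  rw [h4]
  module

/-- If `G` is flat at `y`, then `v(F) Ĝ` has curvature
`R(u, x) w = C (H(x, w) u - H(u, w) x)` at `y`. -/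
theorem localCurvature_localHat [FiniteDimensional ℝ E] (hα : α ≠ 1) (hα' : α ≠ 0)
    (h : ∀ᶠ z in 𝓝 y, IsLocalPairAt G F P α z) (hv : ∀ᶠ r in 𝓝 (F y), IsProfileAt α C v s r)
    (u x w : E) (hflat : localCurvature G y u x w = 0) :
    localCurvature (localHat v α G F) y u x w =
      C • (localHat v α G F y x w • u - localHat v α G F y u w • x) := by
  have hy := h.self_of_nhds
  have hF : F y ≠ 0 := hy.pos.ne'
  have hvy := hv.self_of_nhds
  have hs : ∀ᶠ z in 𝓝 y, ∀ u v, G z u v = G z v u := h.mono fun z hz ↦ hz.symm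
  have c1 := christoffel_comm hy.differentiableAt_metric hs x u
  have e1 := hy.symm x u
  have hP (z : E) : G y z (P y) = fderiv ℝ F y z := by rw [hy.symm, hy.grad]
  unfold localCurvature at hflat ⊢
  rw [fderiv_christoffel_localHat hα h hv, fderiv_christoffel_localHat hα h hv]
  simp only [christoffel_localHat hα h hvy, localHat, hatForm_apply]
  simp only [christoffel_add_right, christoffel_smul_right, map_add, map_smul, smul_eq_mul,
    hP, hy.euler, c1, e1]
  have hE := hvy.energy
  generalize fderiv ℝ (fun z ↦ christoffel G z x w) y u = D₁ at *
  generalize fderiv ℝ (fun z ↦ christoffel G z u w) y x = D₂ at *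
  -- Flatness of G is used here: it eliminates the antisymmetrised derivative of the Christoffel
  -- symbols of G, leaving an algebraic identity.
  have hD : D₁ = D₂ - christoffel G y u (christoffel G y x w)
      + christoffel G y x (christoffel G y u w) := by
    rw [← sub_eq_zero, ← hflat]; abel
  rw [hD]
  match_scalars
  iterate 4 (· ring)
  -- The next three goals compare the coefficients of x, P and u; `energy` trades s² for Cv.
  · field_simp
    linear_combination (fderiv ℝ F y u * fderiv ℝ F y w - F y * α * G y u w) * hE
  · field_simp
    linear_combination -(F y * (fderiv ℝ F y u * G y x w - fderiv ℝ F y x * G y u w)) * hE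
  · field_simp
    linear_combination (F y * α * G y x w - fderiv ℝ F y x * fderiv ℝ F y w) * hE
  all_goals ring

/-! ### Infinitesimal identities from local flows; dependence on germs. -/

section LocalFlow

/-- The vector field `∂_t Ψ(0, z)` generating a local flow `Ψ`. -/
def flowField (Ψ : ℝ × E → E) (z : E) : E := fderiv ℝ Ψ (0, z) (1, 0)

variable {Ψ : ℝ × E → E} {z : E}

lemma contDiffAt_flowField {n m : ℕ∞ω} (hΨ : ContDiffAt ℝ n Ψ (0, z)) (hmn : m + 1 ≤ n) :
    ContDiffAt ℝ m (flowField Ψ) z := by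
  have h1 : ContDiffAt ℝ m (fderiv ℝ Ψ) (0, z) := hΨ.fderiv_right hmn
  have h2 : ContDiffAt ℝ m (fun z : E ↦ ((0 : ℝ), z)) z := contDiffAt_const.prodMk contDiffAt_id
  exact (h1.comp z h2).clm_apply contDiffAt_const

lemma hasDerivAt_flow (hΨ : DifferentiableAt ℝ Ψ (0, z)) :
    HasDerivAt (fun t : ℝ ↦ Ψ (t, z)) (flowField Ψ z) 0 := by
  have h1 : HasDerivAt (fun t : ℝ ↦ (t, z)) ((1 : ℝ), (0 : E)) 0 :=
    (hasDerivAt_id (0 : ℝ)).prodMk (hasDerivAt_const 0 z)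
  exact hΨ.hasFDerivAt.comp_hasDerivAt 0 h1

lemma fderiv_flow_snd {t : ℝ} (hΨ : DifferentiableAt ℝ Ψ (t, z)) (u : E) :
    fderiv ℝ (fun z ↦ Ψ (t, z)) z u = fderiv ℝ Ψ (t, z) (0, u) := by
  have h1 : HasFDerivAt (fun z : E ↦ (t, z)) (ContinuousLinearMap.inr ℝ ℝ E) z :=
    hasFDerivAt_prodMk_right t z
  have h2 := hΨ.hasFDerivAt.comp z h1
  rw [show (fun z ↦ Ψ (t, z)) = Ψ ∘ fun z ↦ (t, z) from rfl, h2.fderiv]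
  simp

/-- By the symmetry of second derivatives, the differential of the flow `Ψ_t` has `t`-derivative
`D P` at `t = 0`. -/
lemma hasDerivAt_fderiv_flow (hΨ : ContDiffAt ℝ 2 Ψ (0, z)) (u : E) :
    HasDerivAt (fun t : ℝ ↦ fderiv ℝ Ψ (t, z) (0, u)) (fderiv ℝ (flowField Ψ) z u) 0 := by
  have h0 : DifferentiableAt ℝ (fderiv ℝ Ψ) (0, z) :=
    (hΨ.fderiv_right (m := 1) (by norm_num)).differentiableAt (by norm_num)
  have h1 : HasDerivAt (fun t : ℝ ↦ (t, z)) ((1 : ℝ), (0 : E)) 0 :=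
    (hasDerivAt_id (0 : ℝ)).prodMk (hasDerivAt_const 0 z)
  have h2 : HasFDerivAt (fun z : E ↦ ((0 : ℝ), z)) (ContinuousLinearMap.inr ℝ ℝ E) z :=
    hasFDerivAt_prodMk_right 0 z
  have h3 : HasFDerivAt (flowField Ψ) _ z :=
    (ContinuousLinearMap.apply ℝ E ((1 : ℝ), (0 : E))).hasFDerivAt.comp z
      (h0.hasFDerivAt.comp z h2)
  have h4 : HasDerivAt (fun t : ℝ ↦ fderiv ℝ Ψ (t, z) (0, u)) _ 0 :=
    (ContinuousLinearMap.apply ℝ E ((0 : ℝ), u)).hasFDerivAt.comp_hasDerivAt 0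
      (h0.hasFDerivAt.comp_hasDerivAt 0 h1)
  convert! h4 using 1
  rw [h3.fderiv]
  exact (hΨ.isSymmSndFDerivAt (by simp)).eq (0, u) (1, 0)

/-- Differentiating `Ψ_t^* G = e^{α t} G` at `t = 0` gives `𝓛_P G = α G`. -/
lemma lie_metric_of_flow {G : E → E →L[ℝ] E →L[ℝ] ℝ} {α : ℝ} (hG : DifferentiableAt ℝ G z)
    (hΨ : ContDiffAt ℝ 2 Ψ (0, z)) (h0 : ∀ᶠ z' in 𝓝 z, Ψ (0, z') = z') (u v : E)
    (h : ∀ᶠ t in 𝓝 (0 : ℝ), G (Ψ (t, z)) (fderiv ℝ Ψ (t, z) (0, u)) (fderiv ℝ Ψ (t, z) (0, v)) =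
      Real.exp (α * t) * G z u v) :
    fderiv ℝ G z (flowField Ψ z) u v + G z (fderiv ℝ (flowField Ψ) z u) v
      + G z u (fderiv ℝ (flowField Ψ) z v) = α * G z u v := by
  have hΨd : DifferentiableAt ℝ Ψ (0, z) := hΨ.differentiableAt (by norm_num)
  have hz : Ψ (0, z) = z := h0.self_of_nhds
  -- That Ψ₀ has identity differential at z needs Ψ₀ to be the identity on a neighbourhood, not just
  -- at z.
  have hid (w : E) : fderiv ℝ Ψ (0, z) (0, w) = w := by
    rw [← fderiv_flow_snd hΨd, EventuallyEq.fderiv_eq (f := id) h0, fderiv_id]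
    rfl
  have hG' : HasFDerivAt G (fderiv ℝ G z) (Ψ (0, z)) := by rw [hz]; exact hG.hasFDerivAt
  have h1 := ((hG'.comp_hasDerivAt (0 : ℝ) (hasDerivAt_flow hΨd)).clm_apply
    (hasDerivAt_fderiv_flow hΨ u)).clm_apply (hasDerivAt_fderiv_flow hΨ v)
  have h2 : HasDerivAt (fun t : ℝ ↦ Real.exp (α * t) * G z u v) (α * G z u v) 0 := by
    have := ((hasDerivAt_id (0 : ℝ)).const_mul α).exp.mul_const (G z u v)
    simpa using this
  have h3 := (h2.congr_of_eventuallyEq h).unique h1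
  simp only [Function.comp_apply, hz, hid, add_apply] at h3
  rw [h3]

lemma euler_of_flow {F : E → ℝ} {α : ℝ} (hF : DifferentiableAt ℝ F z)
    (hΨ : DifferentiableAt ℝ Ψ (0, z)) (hz : Ψ (0, z) = z)
    (h : ∀ᶠ t in 𝓝 (0 : ℝ), F (Ψ (t, z)) = Real.exp (α * t) * F z) :
    fderiv ℝ F z (flowField Ψ z) = α * F z := by
  have hF' : HasFDerivAt F (fderiv ℝ F z) (Ψ (0, z)) := by rw [hz]; exact hF.hasFDerivAt
  have h1 := hF'.comp_hasDerivAt (0 : ℝ) (hasDerivAt_flow hΨ)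
  have h2 : HasDerivAt (fun t : ℝ ↦ Real.exp (α * t) * F z) (α * F z) 0 := by
    have := ((hasDerivAt_id (0 : ℝ)).const_mul α).exp.mul_const (F z)
    simpa using this
  exact ((h2.congr_of_eventuallyEq h).unique h1).symm

lemma christoffel_congr {G G' : E → E →L[ℝ] E →L[ℝ] ℝ} {y : E} (h : G =ᶠ[𝓝 y] G') (u v : E) :
    christoffel G y u v = christoffel G' y u v := by
  simp only [christoffel, koszulForm, h.fderiv_eq, h.eq_of_nhds]

/-- Curvature depends only on the germ of the metric. This matters because chart expressions are
controlled only on the target of the chart. -/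
lemma localCurvature_congr {G G' : E → E →L[ℝ] E →L[ℝ] ℝ} {y : E} (h : G =ᶠ[𝓝 y] G')
    (u v w : E) : localCurvature G y u v w = localCurvature G' y u v w := by
  have h1 (a b : E) : (fun z ↦ christoffel G z a b) =ᶠ[𝓝 y] fun z ↦ christoffel G' z a b := by
    filter_upwards [h.eventually_nhds] with z hz
    exact christoffel_congr hz a b
  simp only [localCurvature, (h1 _ _).fderiv_eq, christoffel_congr h]

lemma contDiffAt_localHat {G : E → E →L[ℝ] E →L[ℝ] ℝ} {F : E → ℝ} {α : ℝ} {v : ℝ → ℝ} {y : E}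
    (hG : ContDiffAt ℝ ∞ G y) (hF : ContDiffAt ℝ ∞ F y) (hy : F y ≠ 0)
    (hv : ContDiffAt ℝ ∞ v (F y)) : ContDiffAt ℝ ∞ (localHat v α G F) y := by
  have h1 : ContDiffAt ℝ ∞ (fderiv ℝ F) y := hF.fderiv_right (by simp)
  have h2 : ContDiffAt ℝ ∞ (fun z ↦ (fderiv ℝ F z).smulRight (fderiv ℝ F z)) y :=
    ((ContinuousLinearMap.smulRightL ℝ E (E →L[ℝ] ℝ)).contDiff.contDiffAt.comp y h1).clm_apply h1
  exact (hv.comp y hF).smul (((hF.inv hy).smul h2).add (hG.const_smul (1 - α)))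

end LocalFlow

end LocalGeometry

/-! ### Bilinear fields and functions in charts. -/

section Chart

variable {E : Type*} [NormedAddCommGroup E] [NormedSpace ℝ E]
  {M : Type*} [TopologicalSpace M] [ChartedSpace E M]

lemma metricInChart_apply (g : BilinField E M) (x : M) (y : E) (u v : E) :
    metricInChart g x y u v = g ((extChartAt 𝓘(ℝ, E) x).symm y)
      (mfderiv 𝓘(ℝ, E) 𝓘(ℝ, E) (extChartAt 𝓘(ℝ, E) x).symm y u)
      (mfderiv 𝓘(ℝ, E) 𝓘(ℝ, E) (extChartAt 𝓘(ℝ, E) x).symm y v) :=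
  rfl

variable [IsManifold 𝓘(ℝ, E) ∞ M]

/-- The inverse of the tangent trivialization is the derivative of the inverse chart, so the bundle
coordinates of a bilinear field are its pullback. This converts smoothness of sections into ordinary
smoothness. -/
lemma trivializationAt_bilinField (g : BilinField E M) {x₀ x : M}
    (hx : x ∈ (chartAt E x₀).source) :
    (trivializationAt (E →L[ℝ] E →L[ℝ] ℝ)
      (fun x : M ↦ TangentSpace 𝓘(ℝ, E) x →L[ℝ] TangentSpace 𝓘(ℝ, E) x →L[ℝ] ℝ) x₀
      ⟨x, g x⟩).2 = metricInChart g x₀ (extChartAt 𝓘(ℝ, E) x₀ x) := by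
  have : IsManifold 𝓘(ℝ, E) 1 M := IsManifold.of_le (n := ∞) (by norm_num)
  rw [hom_trivializationAt_apply]
  ext u v
  have hx' : x ∈ (extChartAt 𝓘(ℝ, E) x₀).source := by simpa using hx
  have hsymm (u : E) : (trivializationAt E (TangentSpace 𝓘(ℝ, E)) x₀).symm x u =
      mfderiv 𝓘(ℝ, E) 𝓘(ℝ, E) (extChartAt 𝓘(ℝ, E) x₀).symm (extChartAt 𝓘(ℝ, E) x₀ x) u := by
    have := TangentBundle.symmL_trivializationAt (I := 𝓘(ℝ, E)) hx
    rw [modelWithCornersSelf_coe, Set.range_id, mfderivWithin_univ] at this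
    exact ((trivializationAt E (TangentSpace 𝓘(ℝ, E)) x₀).symmL_apply (R := ℝ)
      (by simpa using hx) u).symm.trans (DFunLike.congr_fun (F := E →L[ℝ] E) this u)
  rw [inCoordinates_apply_eq₂ (by simpa using hx) (by simpa using hx) (by simp)]
  -- Forgetting that the type of g x depends on x permits rewriting the base point.
  let g' : M → E →L[ℝ] E →L[ℝ] ℝ := g
  change _ = g' ((extChartAt 𝓘(ℝ, E) x₀).symm (extChartAt 𝓘(ℝ, E) x₀ x)) _ _
  rw [(extChartAt 𝓘(ℝ, E) x₀).left_inv hx', hsymm, hsymm]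
  simp [g']
  rfl

lemma contMDiffAt_bilinField_iff (g : BilinField E M) (x₀ : M) :
    ContMDiffAt 𝓘(ℝ, E) (𝓘(ℝ, E).prod 𝓘(ℝ, E →L[ℝ] E →L[ℝ] ℝ)) ∞
      (fun x ↦ Bundle.TotalSpace.mk' (E →L[ℝ] E →L[ℝ] ℝ)
        (E := fun x ↦ TangentSpace 𝓘(ℝ, E) x →L[ℝ] TangentSpace 𝓘(ℝ, E) x →L[ℝ] ℝ) x (g x)) x₀ ↔
      ContDiffAt ℝ ∞ (metricInChart g x₀) (extChartAt 𝓘(ℝ, E) x₀ x₀) := by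
  have hev : (fun x ↦ (trivializationAt (E →L[ℝ] E →L[ℝ] ℝ)
      (fun x : M ↦ TangentSpace 𝓘(ℝ, E) x →L[ℝ] TangentSpace 𝓘(ℝ, E) x →L[ℝ] ℝ) x₀
      ⟨x, g x⟩).2) =ᶠ[𝓝 x₀] metricInChart g x₀ ∘ extChartAt 𝓘(ℝ, E) x₀ := by
    filter_upwards [(chartAt E x₀).open_source.mem_nhds (mem_chart_source E x₀)] with x hx
    exact trivializationAt_bilinField g hx
  rw [Bundle.contMDiffAt_section, hev.contMDiffAt_iff, ← contMDiffAt_iff_contDiffAt]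
  constructor
  · intro h
    have hx : (extChartAt 𝓘(ℝ, E) x₀).symm (extChartAt 𝓘(ℝ, E) x₀ x₀) = x₀ :=
      extChartAt_to_inv x₀
    have h2 : ContMDiffAt 𝓘(ℝ, E) 𝓘(ℝ, E) ∞ (extChartAt 𝓘(ℝ, E) x₀).symm
        (extChartAt 𝓘(ℝ, E) x₀ x₀) :=
      (contMDiffOn_extChartAt_symm x₀).contMDiffAt (extChartAt_target_mem_nhds x₀)
    have h3 := ContMDiffAt.comp (extChartAt 𝓘(ℝ, E) x₀ x₀) (by rwa [hx]) h2
    refine h3.congr_of_eventuallyEq ?_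
    filter_upwards [extChartAt_target_mem_nhds (I := 𝓘(ℝ, E)) x₀] with z hz
    simp only [Function.comp_apply, (extChartAt 𝓘(ℝ, E) x₀).right_inv hz]
  · intro h
    exact h.comp x₀ contMDiffAt_extChartAt

omit [IsManifold 𝓘(ℝ, E) ∞ M] in
lemma extChartAt_target_mem_nhds_of_mem {x₀ : M} {z : E}
    (hz : z ∈ (extChartAt 𝓘(ℝ, E) x₀).target) : (extChartAt 𝓘(ℝ, E) x₀).target ∈ 𝓝 z :=
  (isOpen_extChartAt_target x₀).mem_nhds hz

lemma contMDiffAt_extChartAt_symm {x₀ : M} {z : E} (hz : z ∈ (extChartAt 𝓘(ℝ, E) x₀).target) :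
    ContMDiffAt 𝓘(ℝ, E) 𝓘(ℝ, E) ∞ (extChartAt 𝓘(ℝ, E) x₀).symm z :=
  (contMDiffOn_extChartAt_symm x₀).contMDiffAt (extChartAt_target_mem_nhds_of_mem hz)

lemma isInvertible_mfderiv_extChartAt_symm {x₀ : M} {z : E}
    (hz : z ∈ (extChartAt 𝓘(ℝ, E) x₀).target) :
    (mfderiv 𝓘(ℝ, E) 𝓘(ℝ, E) (extChartAt 𝓘(ℝ, E) x₀).symm z).IsInvertible := by
  have : IsManifold 𝓘(ℝ, E) 1 M := IsManifold.of_le (n := ∞) (by norm_num)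
  have h := isInvertible_mfderivWithin_extChartAt_symm hz
  rwa [modelWithCornersSelf_coe, Set.range_id, mfderivWithin_univ] at h

lemma mvfderiv_extChartAt_symm {f : M → ℝ} (hf : ContMDiff 𝓘(ℝ, E) 𝓘(ℝ, ℝ) ∞ f) {x₀ : M} {z : E}
    (hz : z ∈ (extChartAt 𝓘(ℝ, E) x₀).target) (u : E) :
    mvfderiv 𝓘(ℝ, E) f ((extChartAt 𝓘(ℝ, E) x₀).symm z)
      (mfderiv 𝓘(ℝ, E) 𝓘(ℝ, E) (extChartAt 𝓘(ℝ, E) x₀).symm z u) =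
    fderiv ℝ (f ∘ (extChartAt 𝓘(ℝ, E) x₀).symm) z u := by
  rw [← mfderiv_eq_fderiv, mfderiv_comp z ((hf _).mdifferentiableAt (by simp))
    ((contMDiffAt_extChartAt_symm hz).mdifferentiableAt (by simp))]
  rfl

lemma contDiffAt_comp_extChartAt_symm {f : M → ℝ} (hf : ContMDiff 𝓘(ℝ, E) 𝓘(ℝ, ℝ) ∞ f) {x₀ : M}
    {z : E} (hz : z ∈ (extChartAt 𝓘(ℝ, E) x₀).target) :
    ContDiffAt ℝ ∞ (f ∘ (extChartAt 𝓘(ℝ, E) x₀).symm) z :=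
  contMDiffAt_iff_contDiffAt.1 ((hf _).comp z (contMDiffAt_extChartAt_symm hz))

omit [IsManifold 𝓘(ℝ, E) ∞ M] in
lemma conformal_hatMetric_apply (g : BilinField E M) (f : M → ℝ) (v : ℝ → ℝ) (α : ℝ) (x : M)
    (u w : TangentSpace 𝓘(ℝ, E) x) :
    conformal v f (hatMetric g f α) x u w = v (f x) *
      ((f x)⁻¹ * (mvfderiv 𝓘(ℝ, E) f x u * mvfderiv 𝓘(ℝ, E) f x w) + (1 - α) * g x u w) := by
  simp only [conformal, hatMetric, smul_apply, add_apply, ContinuousLinearMap.smulRight_apply,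
    smul_eq_mul]

/-- The chart expression of `v(f) ĝ`. -/
lemma metricInChart_conformal_hatMetric {g : BilinField E M} {f : M → ℝ}
    (hf : ContMDiff 𝓘(ℝ, E) 𝓘(ℝ, ℝ) ∞ f) (v : ℝ → ℝ) (α : ℝ) {x₀ : M} {z : E}
    (hz : z ∈ (extChartAt 𝓘(ℝ, E) x₀).target) :
    metricInChart (conformal v f (hatMetric g f α)) x₀ z =
      localHat v α (metricInChart g x₀) (f ∘ (extChartAt 𝓘(ℝ, E) x₀).symm) z := by
  ext u w
  rw [localHat, hatForm_apply, metricInChart_apply, conformal_hatMetric_apply,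
    mvfderiv_extChartAt_symm hf hz, mvfderiv_extChartAt_symm hf hz, metricInChart_apply]
  rfl

/-! ### The flow in a chart -/

/-- The flow `(t, z) ↦ m(e^t, z)` of a homogeneous pair, read in the chart at `x₀`. -/
def chartFlow (m : ℝ → M → M) (x₀ : M) (p : ℝ × E) : E :=
  extChartAt 𝓘(ℝ, E) x₀ (m (Real.exp p.1) ((extChartAt 𝓘(ℝ, E) x₀).symm p.2))

variable {m : ℝ → M → M}

lemma IsFreePosAction.contMDiffAt_flow (hm : IsFreePosAction E m) {x₀ : M} {t : ℝ} {z : E}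
    (hz : z ∈ (extChartAt 𝓘(ℝ, E) x₀).target) :
    ContMDiffAt 𝓘(ℝ, ℝ × E) 𝓘(ℝ, E) ∞
      (fun p : ℝ × E ↦ m (Real.exp p.1) ((extChartAt 𝓘(ℝ, E) x₀).symm p.2)) (t, z) := by
  have h1 : ContMDiffAt (𝓘(ℝ, ℝ).prod 𝓘(ℝ, E)) 𝓘(ℝ, E) ∞ (fun p : ℝ × M ↦ m p.1 p.2)
      (Real.exp t, (extChartAt 𝓘(ℝ, E) x₀).symm z) :=
    hm.smooth.contMDiffAt ((isOpen_Ioi.prod isOpen_univ).mem_nhds ⟨Real.exp_pos t, trivial⟩)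
  have h2 : ContMDiffAt 𝓘(ℝ, ℝ × E) 𝓘(ℝ, ℝ) ∞ (fun p : ℝ × E ↦ Real.exp p.1) (t, z) :=
    (Real.contDiff_exp.comp contDiff_fst).contMDiff _
  have h3 : ContMDiffAt 𝓘(ℝ, ℝ × E) 𝓘(ℝ, E) ∞
      (fun p : ℝ × E ↦ (extChartAt 𝓘(ℝ, E) x₀).symm p.2) (t, z) :=
    ContMDiffAt.comp (t, z) (contMDiffAt_extChartAt_symm hz) (contDiff_snd.contMDiff _)
  exact ContMDiffAt.comp (t, z) h1 (h2.prodMk h3)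

lemma IsFreePosAction.contDiffAt_chartFlow (hm : IsFreePosAction E m) {x₀ : M} {t : ℝ} {z : E}
    (hz : z ∈ (extChartAt 𝓘(ℝ, E) x₀).target)
    (ht : m (Real.exp t) ((extChartAt 𝓘(ℝ, E) x₀).symm z) ∈ (extChartAt 𝓘(ℝ, E) x₀).source) :
    ContDiffAt ℝ ∞ (chartFlow m x₀) (t, z) := by
  rw [← contMDiffAt_iff_contDiffAt]
  exact ContMDiffAt.comp (t, z) (contMDiffAt_extChartAt' (by simpa using ht))
    (hm.contMDiffAt_flow hz)

lemma IsFreePosAction.eventually_mem_source (hm : IsFreePosAction E m) {x₀ : M} {t : ℝ} {z : E}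
    (hz : z ∈ (extChartAt 𝓘(ℝ, E) x₀).target)
    (ht : m (Real.exp t) ((extChartAt 𝓘(ℝ, E) x₀).symm z) ∈ (extChartAt 𝓘(ℝ, E) x₀).source) :
    ∀ᶠ p : ℝ × E in 𝓝 (t, z), m (Real.exp p.1) ((extChartAt 𝓘(ℝ, E) x₀).symm p.2) ∈
      (extChartAt 𝓘(ℝ, E) x₀).source :=
  (hm.contMDiffAt_flow hz).continuousAt ((isOpen_extChartAt_source x₀).mem_nhds ht)

end Chart

/-! ### From a homogeneous pair to the local identities. -/

section Pair

variable {E : Type*} [NormedAddCommGroup E] [NormedSpace ℝ E]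
  {M : Type*} [TopologicalSpace M] [ChartedSpace E M] [IsManifold 𝓘(ℝ, E) ∞ M]
  {m : ℝ → M → M}

omit [IsManifold 𝓘(ℝ, E) ∞ M] in
lemma IsFreePosAction.contMDiff_apply (hm : IsFreePosAction E m) {r : ℝ} (hr : 0 < r) :
    ContMDiff 𝓘(ℝ, E) 𝓘(ℝ, E) ∞ (m r) := fun x ↦ by
  have h1 : ContMDiffAt (𝓘(ℝ, ℝ).prod 𝓘(ℝ, E)) 𝓘(ℝ, E) ∞ (fun p : ℝ × M ↦ m p.1 p.2) (r, x) :=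
    hm.smooth.contMDiffAt ((isOpen_Ioi.prod isOpen_univ).mem_nhds ⟨hr, trivial⟩)
  exact ContMDiffAt.comp (f := fun x : M ↦ (r, x)) x h1 (contMDiffAt_const.prodMk contMDiffAt_id)

omit [IsManifold 𝓘(ℝ, E) ∞ M] in
lemma IsFreePosAction.exp_zero (hm : IsFreePosAction E m) (x : M) : m (Real.exp 0) x = x := by
  rw [Real.exp_zero, hm.one]

omit [IsManifold 𝓘(ℝ, E) ∞ M] in
lemma IsFreePosAction.chartFlow_zero (hm : IsFreePosAction E m) {x₀ : M} {z : E}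
    (hz : z ∈ (extChartAt 𝓘(ℝ, E) x₀).target) : chartFlow m x₀ (0, z) = z := by
  simp only [chartFlow, hm.exp_zero]
  exact (extChartAt 𝓘(ℝ, E) x₀).right_inv hz

lemma IsFreePosAction.contDiffAt_chartFlow_zero (hm : IsFreePosAction E m) {x₀ : M} {z : E}
    (hz : z ∈ (extChartAt 𝓘(ℝ, E) x₀).target) : ContDiffAt ℝ ∞ (chartFlow m x₀) (0, z) :=
  hm.contDiffAt_chartFlow hz (by
    rw [hm.exp_zero]; exact (extChartAt 𝓘(ℝ, E) x₀).map_target hz)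

lemma IsFreePosAction.eventually_mem_source_zero (hm : IsFreePosAction E m) {x₀ : M} {z : E}
    (hz : z ∈ (extChartAt 𝓘(ℝ, E) x₀).target) :
    ∀ᶠ t : ℝ in 𝓝 0, m (Real.exp t) ((extChartAt 𝓘(ℝ, E) x₀).symm z) ∈
      (extChartAt 𝓘(ℝ, E) x₀).source := by
  have h := hm.eventually_mem_source (t := 0) hz (by
    rw [hm.exp_zero]; exact (extChartAt 𝓘(ℝ, E) x₀).map_target hz)
  have hc : ContinuousAt (fun t : ℝ ↦ (t, z)) 0 := by fun_prop
  exact hc.eventually h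

/-- The generating field of the flow in a chart represents the generator of the action. -/
lemma IsFreePosAction.mfderiv_symm_flowField (hm : IsFreePosAction E m) {x₀ : M} {z : E}
    (hz : z ∈ (extChartAt 𝓘(ℝ, E) x₀).target) :
    mfderiv 𝓘(ℝ, E) 𝓘(ℝ, E) (extChartAt 𝓘(ℝ, E) x₀).symm z
      (flowField (E := E) (chartFlow m x₀) z) =
      generator E m ((extChartAt 𝓘(ℝ, E) x₀).symm z) := by
  let D : E → E →L[ℝ] E := fun z ↦ mfderiv 𝓘(ℝ, E) 𝓘(ℝ, E) (extChartAt 𝓘(ℝ, E) x₀).symm z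
  have h0 : chartFlow m x₀ (0, z) = z := hm.chartFlow_zero hz
  have h1 : HasDerivAt (fun t : ℝ ↦ chartFlow m x₀ (t, z)) (flowField (chartFlow m x₀) z) 0 :=
    hasDerivAt_flow ((hm.contDiffAt_chartFlow_zero hz).differentiableAt (by simp))
  have h2 : MDifferentiableAt 𝓘(ℝ, ℝ) 𝓘(ℝ, E) (fun t : ℝ ↦ chartFlow m x₀ (t, z)) 0 :=
    h1.differentiableAt.mdifferentiableAt
  have h3 : MDifferentiableAt 𝓘(ℝ, E) 𝓘(ℝ, E) (extChartAt 𝓘(ℝ, E) x₀).symm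
      (chartFlow m x₀ (0, z)) := by
    rw [h0]; exact (contMDiffAt_extChartAt_symm hz).mdifferentiableAt (by simp)
  -- The orbit is recovered from its chart expression only while it stays in the chart, which
  -- suffices for the derivative at t = 0.
  have hev : (fun t : ℝ ↦ m (Real.exp t) ((extChartAt 𝓘(ℝ, E) x₀).symm z)) =ᶠ[𝓝 0]
      (extChartAt 𝓘(ℝ, E) x₀).symm ∘ fun t : ℝ ↦ chartFlow m x₀ (t, z) := by
    filter_upwards [hm.eventually_mem_source_zero hz] with t ht
    exact ((extChartAt 𝓘(ℝ, E) x₀).left_inv ht).symm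
  have h4 : (mfderiv 𝓘(ℝ, ℝ) 𝓘(ℝ, E)
      (fun t : ℝ ↦ m (Real.exp t) ((extChartAt 𝓘(ℝ, E) x₀).symm z)) 0 : ℝ →L[ℝ] E) =
      (D (chartFlow m x₀ (0, z))).comp (fderiv ℝ (fun t : ℝ ↦ chartFlow m x₀ (t, z)) 0) := by
    refine hev.mfderiv_eq.trans ?_
    rw [mfderiv_comp (0 : ℝ) h3 h2, mfderiv_eq_fderiv]
    rfl
  rw [h0] at h4
  refine Eq.trans ?_ (DFunLike.congr_fun (F := ℝ →L[ℝ] E) h4.symm 1)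
  change D z _ = D z (fderiv ℝ (fun t : ℝ ↦ chartFlow m x₀ (t, z)) 0 1)
  rw [fderiv_apply_one_eq_deriv, h1.deriv]

/-- The action of `e^t` in a chart has the same effect on tangent vectors. -/
lemma IsFreePosAction.mfderiv_symm_fderiv_chartFlow (hm : IsFreePosAction E m) {x₀ : M} {t : ℝ}
    {z : E} (hz : z ∈ (extChartAt 𝓘(ℝ, E) x₀).target)
    (ht : m (Real.exp t) ((extChartAt 𝓘(ℝ, E) x₀).symm z) ∈ (extChartAt 𝓘(ℝ, E) x₀).source)
    (u : E) :
    (mfderiv 𝓘(ℝ, E) 𝓘(ℝ, E) (extChartAt 𝓘(ℝ, E) x₀).symm (chartFlow m x₀ (t, z))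
      (fderiv ℝ (chartFlow m x₀) (t, z) (0, u)) : E) =
    mfderiv 𝓘(ℝ, E) 𝓘(ℝ, E) (m (Real.exp t)) ((extChartAt 𝓘(ℝ, E) x₀).symm z)
      (mfderiv 𝓘(ℝ, E) 𝓘(ℝ, E) (extChartAt 𝓘(ℝ, E) x₀).symm z u) := by
  have h1 : DifferentiableAt ℝ (chartFlow m x₀) (t, z) :=
    (hm.contDiffAt_chartFlow hz ht).differentiableAt (by simp)
  have h2 : MDifferentiableAt 𝓘(ℝ, E) 𝓘(ℝ, E) (fun z ↦ chartFlow m x₀ (t, z)) z := by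
    have : DifferentiableAt ℝ (fun z : E ↦ (t, z)) z := by fun_prop
    exact (h1.comp z this).mdifferentiableAt
  have h3 : MDifferentiableAt 𝓘(ℝ, E) 𝓘(ℝ, E) (extChartAt 𝓘(ℝ, E) x₀).symm
      (chartFlow m x₀ (t, z)) :=
    (contMDiffAt_extChartAt_symm ((extChartAt 𝓘(ℝ, E) x₀).map_source ht)).mdifferentiableAt
      (by simp)
  have h4 : MDifferentiableAt 𝓘(ℝ, E) 𝓘(ℝ, E) (extChartAt 𝓘(ℝ, E) x₀).symm z :=
    (contMDiffAt_extChartAt_symm hz).mdifferentiableAt (by simp)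
  have h5 : MDifferentiableAt 𝓘(ℝ, E) 𝓘(ℝ, E) (m (Real.exp t))
      ((extChartAt 𝓘(ℝ, E) x₀).symm z) :=
    (hm.contMDiff_apply (Real.exp_pos t) _).mdifferentiableAt (by simp)
  have hev : (extChartAt 𝓘(ℝ, E) x₀).symm ∘ (fun z ↦ chartFlow m x₀ (t, z)) =ᶠ[𝓝 z]
      m (Real.exp t) ∘ (extChartAt 𝓘(ℝ, E) x₀).symm := by
    have hc : ContinuousAt (fun z : E ↦ (t, z)) z := by fun_prop
    filter_upwards [hc.eventually (hm.eventually_mem_source hz ht)] with z' hz'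
    exact (extChartAt 𝓘(ℝ, E) x₀).left_inv hz'
  have h6 := hev.mfderiv_eq (I := 𝓘(ℝ, E)) (I' := 𝓘(ℝ, E))
  rw [mfderiv_comp z h3 h2, mfderiv_comp z h5 h4, mfderiv_eq_fderiv] at h6
  have h7 := DFunLike.congr_fun (F := E →L[ℝ] E) h6 u
  rw [← fderiv_flow_snd h1]
  exact h7

variable {g : BilinField E M} {f : M → ℝ} {α : ℝ}

lemma IsHomogeneousPair.contDiffAt_metricInChart (h : IsHomogeneousPair m g f α) (x₀ : M) :
    ContDiffAt ℝ ∞ (metricInChart g x₀) (extChartAt 𝓘(ℝ, E) x₀ x₀) :=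
  (contMDiffAt_bilinField_iff g x₀).1 (h.metric.smooth.contMDiffAt univ_mem)

lemma IsHomogeneousPair.metricInChart_symm (h : IsHomogeneousPair m g f α) (x₀ : M) (z u v : E) :
    metricInChart g x₀ z u v = metricInChart g x₀ z v u := by
  rw [metricInChart_apply, h.metric.symm _ trivial, ← metricInChart_apply]

lemma IsHomogeneousPair.metricInChart_nondegenerate (h : IsHomogeneousPair m g f α) {x₀ : M} {z : E}
    (hz : z ∈ (extChartAt 𝓘(ℝ, E) x₀).target) (u : E)
    (hu : ∀ v, metricInChart g x₀ z u v = 0) : u = 0 := by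
  have hD := isInvertible_mfderiv_extChartAt_symm hz
  apply hD.injective
  refine Eq.trans (h.metric.nondegenerate _ trivial _ fun v ↦ ?_)
    (ContinuousLinearMap.map_zero _).symm
  obtain ⟨w, rfl⟩ := hD.surjective v
  exact hu w

lemma IsHomogeneousPair.metricInChart_flowField (h : IsHomogeneousPair m g f α) {x₀ : M} {z : E}
    (hz : z ∈ (extChartAt 𝓘(ℝ, E) x₀).target) (v : E) :
    metricInChart g x₀ z (flowField (chartFlow m x₀) z) v =
      fderiv ℝ (f ∘ (extChartAt 𝓘(ℝ, E) x₀).symm) z v := by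
  rw [metricInChart_apply, h.action.mfderiv_symm_flowField hz, h.grad,
    mvfderiv_extChartAt_symm h.smooth hz]

lemma IsHomogeneousPair.fderiv_flowField (h : IsHomogeneousPair m g f α) {x₀ : M} {z : E}
    (hz : z ∈ (extChartAt 𝓘(ℝ, E) x₀).target) :
    fderiv ℝ (f ∘ (extChartAt 𝓘(ℝ, E) x₀).symm) z (flowField (chartFlow m x₀) z) =
      α * (f ∘ (extChartAt 𝓘(ℝ, E) x₀).symm) z := by
  refine euler_of_flow ((contDiffAt_comp_extChartAt_symm h.smooth hz).differentiableAt (by simp))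
    ((h.action.contDiffAt_chartFlow_zero hz).differentiableAt (by simp))
    (h.action.chartFlow_zero hz) ?_
  filter_upwards [h.action.eventually_mem_source_zero hz] with t ht
  rw [Function.comp_apply, chartFlow, (extChartAt 𝓘(ℝ, E) x₀).left_inv ht,
    h.homog_fun _ (Real.exp_pos t), ← Real.exp_mul, mul_comm t]
  rfl

lemma IsHomogeneousPair.metricInChart_chartFlow (h : IsHomogeneousPair m g f α) {x₀ : M} {t : ℝ}
    {z : E} (hz : z ∈ (extChartAt 𝓘(ℝ, E) x₀).target)
    (ht : m (Real.exp t) ((extChartAt 𝓘(ℝ, E) x₀).symm z) ∈ (extChartAt 𝓘(ℝ, E) x₀).source)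
    (u v : E) :
    metricInChart g x₀ (chartFlow m x₀ (t, z)) (fderiv ℝ (chartFlow m x₀) (t, z) (0, u))
      (fderiv ℝ (chartFlow m x₀) (t, z) (0, v)) =
    Real.exp (α * t) * metricInChart g x₀ z u v := by
  let g' : M → E →L[ℝ] E →L[ℝ] ℝ := g
  have hx : (extChartAt 𝓘(ℝ, E) x₀).symm (chartFlow m x₀ (t, z)) =
      m (Real.exp t) ((extChartAt 𝓘(ℝ, E) x₀).symm z) :=
    (extChartAt 𝓘(ℝ, E) x₀).left_inv ht
  have h1 := h.action.mfderiv_symm_fderiv_chartFlow hz ht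
  rw [metricInChart_apply]
  change g' ((extChartAt 𝓘(ℝ, E) x₀).symm (chartFlow m x₀ (t, z))) _ _ = _
  rw [hx]
  refine (congrArg₂ (fun a b ↦ g' (m (Real.exp t) ((extChartAt 𝓘(ℝ, E) x₀).symm z)) a b)
    (h1 u) (h1 v)).trans ?_
  refine (h.homog_metric _ (Real.exp_pos t) _ _ _).trans ?_
  rw [← Real.exp_mul, mul_comm t, metricInChart_apply]

lemma IsHomogeneousPair.isLocalPairAt (h : IsHomogeneousPair m g f α) {x₀ : M} {z : E}
    (hz : z ∈ (extChartAt 𝓘(ℝ, E) x₀).target) (hG : ContDiffAt ℝ 2 (metricInChart g x₀) z) :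
    IsLocalPairAt (metricInChart g x₀) (f ∘ (extChartAt 𝓘(ℝ, E) x₀).symm)
      (flowField (chartFlow m x₀)) α z where
  contDiffAt_metric := hG
  contDiffAt_fun := (contDiffAt_comp_extChartAt_symm h.smooth hz).of_le (ENat.LEInfty.out)
  contDiffAt_field := contDiffAt_flowField (h.action.contDiffAt_chartFlow_zero hz) (by
    rw [one_add_one_eq_two]; exact ENat.LEInfty.out)
  symm := h.metricInChart_symm x₀ z
  nondegenerate := h.metricInChart_nondegenerate hz
  pos := h.pos _
  grad := h.metricInChart_flowField hz
  euler := h.fderiv_flowField hz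
  lie u v := by
    refine lie_metric_of_flow (hG.differentiableAt (by norm_num))
      ((h.action.contDiffAt_chartFlow_zero hz).of_le (ENat.LEInfty.out)) ?_ u v ?_
    · filter_upwards [extChartAt_target_mem_nhds_of_mem hz] with z' hz'
      exact h.action.chartFlow_zero hz'
    · filter_upwards [h.action.eventually_mem_source_zero hz] with t ht
      exact h.metricInChart_chartFlow hz ht u v

lemma IsHomogeneousPair.eventually_isLocalPairAt (h : IsHomogeneousPair m g f α) (x₀ : M) :
    ∀ᶠ z in 𝓝 (extChartAt 𝓘(ℝ, E) x₀ x₀),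
      IsLocalPairAt (metricInChart g x₀) (f ∘ (extChartAt 𝓘(ℝ, E) x₀).symm)
        (flowField (chartFlow m x₀)) α z := by
  -- Smoothness of the chart expression is available at the chart centre only. Finite order of
  -- differentiability at a point spreads to a neighbourhood, and C² is all that the local argument
  -- needs.
  have h2 : ContDiffAt ℝ 2 (metricInChart g x₀) (extChartAt 𝓘(ℝ, E) x₀ x₀) :=
    (h.contDiffAt_metricInChart x₀).of_le (ENat.LEInfty.out)
  filter_upwards [extChartAt_target_mem_nhds (I := 𝓘(ℝ, E)) x₀, h2.eventually (by simp)]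
    with z hz hG
  exact h.isLocalPairAt hz hG

end Pair

/-! ### Curvature and nondegeneracy on the manifold. -/

section Conformal

variable {E : Type*} [NormedAddCommGroup E] [NormedSpace ℝ E]
  {M : Type*} [TopologicalSpace M] [ChartedSpace E M] [IsManifold 𝓘(ℝ, E) ∞ M]

/-- Tangent vectors at x are by convention their coordinates in the preferred chart at x. Pointwise
values of metric and curvature can therefore be compared with the chart expressions without any
transport. -/
lemma mfderiv_extChartAt_symm_self (x : M) (u : E) :
    mfderiv 𝓘(ℝ, E) 𝓘(ℝ, E) (extChartAt 𝓘(ℝ, E) x).symm (extChartAt 𝓘(ℝ, E) x x) u = u := by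
  have : IsManifold 𝓘(ℝ, E) 1 M := IsManifold.of_le (n := ∞) (by norm_num)
  have h := mfderivWithin_extChartAt_symm_comp_mfderiv_extChartAt' (I := 𝓘(ℝ, E))
    (mem_extChartAt_source (I := 𝓘(ℝ, E)) x)
  rw [modelWithCornersSelf_coe, Set.range_id, mfderivWithin_univ, mfderiv_extChartAt_self] at h
  exact DFunLike.congr_fun (F := E →L[ℝ] E) h u

lemma metricInChart_self (g : BilinField E M) (x : M) (u v : E) :
    metricInChart g x (extChartAt 𝓘(ℝ, E) x x) u v = g x u v := by
  let g' : M → E →L[ℝ] E →L[ℝ] ℝ := g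
  rw [metricInChart_apply]
  change g' ((extChartAt 𝓘(ℝ, E) x).symm (extChartAt 𝓘(ℝ, E) x x)) _ _ = g' x u v
  rw [extChartAt_to_inv]
  exact congrArg₂ (fun a b ↦ g' x a b) (mfderiv_extChartAt_symm_self x u)
    (mfderiv_extChartAt_symm_self x v)

lemma curvature_eq_localCurvature (g : BilinField E M) (x : M) (a b c : E) :
    curvature g x a b c =
      localCurvature (metricInChart g x) (extChartAt 𝓘(ℝ, E) x x) a b c := by
  have : IsManifold 𝓘(ℝ, E) 1 M := IsManifold.of_le (n := ∞) (by norm_num)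
  have hD : (mfderiv 𝓘(ℝ, E) 𝓘(ℝ, E) (extChartAt 𝓘(ℝ, E) x) x : E →L[ℝ] E) =
      ContinuousLinearMap.id ℝ E := mfderiv_extChartAt_self
  have h (D : E →L[ℝ] E) (hD : D = ContinuousLinearMap.id ℝ E) :
      D.inverse (localCurvature (metricInChart g x) (extChartAt 𝓘(ℝ, E) x x) (D a) (D b) (D c)) =
      localCurvature (metricInChart g x) (extChartAt 𝓘(ℝ, E) x x) a b c := by
    subst hD
    simp
  exact h _ hD

variable {m : ℝ → M → M} {g : BilinField E M} {f : M → ℝ} {α C : ℝ} {v s : ℝ → ℝ}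

lemma metricInChart_conformal_eventuallyEq (hf : ContMDiff 𝓘(ℝ, E) 𝓘(ℝ, ℝ) ∞ f) (v : ℝ → ℝ)
    (g : BilinField E M) (α : ℝ) (x : M) :
    metricInChart (conformal v f (hatMetric g f α)) x =ᶠ[𝓝 (extChartAt 𝓘(ℝ, E) x x)]
      localHat v α (metricInChart g x) (f ∘ (extChartAt 𝓘(ℝ, E) x).symm) := by
  filter_upwards [extChartAt_target_mem_nhds (I := 𝓘(ℝ, E)) x] with z hz
  exact metricInChart_conformal_hatMetric hf v α hz

/-- If `v` satisfies the profile equations for `C`, then `v(f) ĝ` has curvature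
`R(a, b) c = C (h(b, c) a - h(a, c) b)`. -/
theorem IsHomogeneousPair.curvature_conformal [FiniteDimensional ℝ E]
    (h : IsHomogeneousPair m g f α) (hα : α ≠ 1) (hflat : IsFlatOn g Set.univ) (x : M)
    (hv : ∀ᶠ r in 𝓝 (f x), IsProfileAt α C v s r) (a b c : TangentSpace 𝓘(ℝ, E) x) :
    curvature (conformal v f (hatMetric g f α)) x a b c =
      C • (conformal v f (hatMetric g f α) x b c • a
        - conformal v f (hatMetric g f α) x a c • b) := by
  have hfx : (f ∘ (extChartAt 𝓘(ℝ, E) x).symm) (extChartAt 𝓘(ℝ, E) x x) = f x := by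
    rw [Function.comp_apply, extChartAt_to_inv]
  have hg : localCurvature (metricInChart g x) (extChartAt 𝓘(ℝ, E) x x) a b c = 0 :=
    (curvature_eq_localCurvature g x a b c).symm.trans (hflat x trivial a b c)
  have hev := metricInChart_conformal_eventuallyEq h.smooth v g α x
  have h1 (a b c : E)
      (hg : localCurvature (metricInChart g x) (extChartAt 𝓘(ℝ, E) x x) a b c = 0) :
      localCurvature (metricInChart (conformal v f (hatMetric g f α)) x)
        (extChartAt 𝓘(ℝ, E) x x) a b c =
      C • (metricInChart (conformal v f (hatMetric g f α)) x (extChartAt 𝓘(ℝ, E) x x) b c • a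
        - metricInChart (conformal v f (hatMetric g f α)) x (extChartAt 𝓘(ℝ, E) x x) a c • b) := by
    rw [localCurvature_congr hev, hev.eq_of_nhds]
    exact localCurvature_localHat hα h.degree_ne_zero (h.eventually_isLocalPairAt x)
      (by rwa [hfx]) a b c hg
  have h2 {p q p' q' : ℝ} (a b : E) (hp : p = p') (hq : q = q') :
      C • (p • a - q • b) = C • (p' • a - q' • b) := by rw [hp, hq]
  exact (curvature_eq_localCurvature (E := E) _ x a b c).trans ((h1 a b c hg).trans
    (h2 a b (metricInChart_self (E := E) _ x b c) (metricInChart_self (E := E) _ x a c)))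

lemma IsHomogeneousPair.conformal_symm (h : IsHomogeneousPair m g f α) (v : ℝ → ℝ) (x : M)
    (a b : TangentSpace 𝓘(ℝ, E) x) :
    conformal v f (hatMetric g f α) x a b = conformal v f (hatMetric g f α) x b a := by
  rw [conformal_hatMetric_apply, conformal_hatMetric_apply, h.metric.symm x trivial a b]
  ring

theorem IsHomogeneousPair.isPseudoRiemannianOn_conformal (h : IsHomogeneousPair m g f α)
    (hα : α ≠ 1) {U : Set M} (hv : ∀ x ∈ U, ContDiffAt ℝ ∞ v (f x)) (hv0 : ∀ x ∈ U, v (f x) ≠ 0) :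
    IsPseudoRiemannianOn (conformal v f (hatMetric g f α)) U where
  smooth x hx := by
    refine ((contMDiffAt_bilinField_iff _ x).2 ?_).contMDiffWithinAt
    have hfx : (f ∘ (extChartAt 𝓘(ℝ, E) x).symm) (extChartAt 𝓘(ℝ, E) x x) = f x := by
      rw [Function.comp_apply, extChartAt_to_inv]
    refine ContDiffAt.congr_of_eventuallyEq ?_
      (metricInChart_conformal_eventuallyEq h.smooth v g α x)
    exact contDiffAt_localHat (h.contDiffAt_metricInChart x)
      (contDiffAt_comp_extChartAt_symm h.smooth (mem_extChartAt_target x))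
      (by rw [hfx]; exact (h.pos x).ne') (by rw [hfx]; exact hv x hx)
  symm x _ := h.conformal_symm v x
  nondegenerate x hx u hu := by
    have hfx : (f ∘ (extChartAt 𝓘(ℝ, E) x).symm) (extChartAt 𝓘(ℝ, E) x x) = f x := by
      rw [Function.comp_apply, extChartAt_to_inv]
    have hy := (h.eventually_isLocalPairAt x).self_of_nhds
    refine hatForm_nondegenerate (c := v (f x)) (by exact hv0 x hx) hy.pos.ne' hα hy.symm hy.grad
      hy.euler hy.nondegenerate u fun w ↦ ?_
    have h1 (u w : E) : metricInChart (conformal v f (hatMetric g f α)) x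
        (extChartAt 𝓘(ℝ, E) x x) u w =
        hatForm (v (f x)) ((f ∘ (extChartAt 𝓘(ℝ, E) x).symm) (extChartAt 𝓘(ℝ, E) x x)) α
          (fderiv ℝ (f ∘ (extChartAt 𝓘(ℝ, E) x).symm) (extChartAt 𝓘(ℝ, E) x x))
          (metricInChart g x (extChartAt 𝓘(ℝ, E) x x)) u w := by
      rw [(metricInChart_conformal_eventuallyEq h.smooth v g α x).eq_of_nhds, localHat, hfx]
    exact (h1 u w).symm.trans ((metricInChart_self (E := E) _ x u w).trans (hu w))

theorem IsHomogeneousPair.hasConstSectionalCurvatureOn_conformal [FiniteDimensional ℝ E]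
    (h : IsHomogeneousPair m g f α) (hα : α ≠ 1) (hflat : IsFlatOn g Set.univ) {U : Set M}
    (hv : ∀ x ∈ U, ∀ᶠ r in 𝓝 (f x), IsProfileAt α C v s r) :
    HasConstSectionalCurvatureOn (conformal v f (hatMetric g f α)) U C := by
  intro x hx a b hab
  -- Pairing R(a, b)b = C(h(b, b)a − h(a, b)b) with a gives C times the Gram determinant.
  rw [sectionalCurvature, h.curvature_conformal hα hflat x (hv x hx), div_eq_iff hab]
  simp only [map_smul, map_sub, smul_apply, sub_apply, smul_eq_mul, h.conformal_symm v x b a]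
  ring

theorem IsHomogeneousPair.isFlatOn_conformal [FiniteDimensional ℝ E]
    (h : IsHomogeneousPair m g f α) (hα : α ≠ 1) (hflat : IsFlatOn g Set.univ) {U : Set M}
    (hv : ∀ x ∈ U, ∀ᶠ r in 𝓝 (f x), IsProfileAt α 0 v s r) :
    IsFlatOn (conformal v f (hatMetric g f α)) U := by
  intro x hx a b c
  rw [h.curvature_conformal hα hflat x (hv x hx), zero_smul]

end Conformal

/-! ### Explicit solutions of the profile equations. -/

section Profiles

variable {α C C₂ r : ℝ}

lemma hasDerivAt_phase (k C₂ : ℝ) (hr : r ≠ 0) :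
    HasDerivAt (fun r ↦ 1 / (2 * k) * (Real.log r + C₂)) (1 / (2 * k) * r⁻¹) r :=
  ((Real.hasDerivAt_log hr).add_const C₂).const_mul _

lemma contDiffAt_phase (k C₂ : ℝ) (hr : r ≠ 0) :
    ContDiffAt ℝ ∞ (fun r ↦ 1 / (2 * k) * (Real.log r + C₂)) r :=
  contDiffAt_const.mul ((Real.contDiffAt_log.2 hr).add contDiffAt_const)

/-- With 1 − α = k², the Riccati equation for s has the solution −tanh θ / k, where θ = (log r +
C₂)/(2k); `energy` then reads cosh² = sinh² + 1 and determines v. -/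
lemma isProfileAt_cosh {k : ℝ} (hk : k ≠ 0) (hk2 : 1 - α = k ^ 2) (hα : α ≠ 0) (hC : C ≠ 0)
    (hr : r ≠ 0) :
    IsProfileAt α C
      (fun r ↦ α / (4 * (1 - α) * C * r * Real.cosh (1 / (2 * k) * (Real.log r + C₂)) ^ 2))
      (fun r ↦ -(Real.sinh (1 / (2 * k) * (Real.log r + C₂)) /
        Real.cosh (1 / (2 * k) * (Real.log r + C₂))) / k) r := by
  rw [hk2]
  have hθ := hasDerivAt_phase k C₂ hr
  have hcs := Real.cosh_sq (1 / (2 * k) * (Real.log r + C₂))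
  have hc : Real.cosh (1 / (2 * k) * (Real.log r + C₂)) ≠ 0 := (Real.cosh_pos _).ne'
  have hdc := hθ.cosh
  have hds := hθ.sinh
  have hden : 4 * k ^ 2 * C * r * Real.cosh (1 / (2 * k) * (Real.log r + C₂)) ^ 2 ≠ 0 := by
    positivity
  refine ⟨div_ne_zero hα hden, ?_, ?_, ?_⟩
  · convert! (hasDerivAt_const r α).fun_div
      (((hasDerivAt_id r).const_mul (4 * k ^ 2 * C)).fun_mul (hdc.fun_pow 2)) hden using 1
    simp only [id]
    generalize Real.cosh (1 / (2 * k) * (Real.log r + C₂)) = c at *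
    generalize Real.sinh (1 / (2 * k) * (Real.log r + C₂)) = d at *
    field_simp
    ring
  · convert! ((hds.fun_div hdc hc).fun_neg.div_const k) using 1
    generalize Real.cosh (1 / (2 * k) * (Real.log r + C₂)) = c at *
    generalize Real.sinh (1 / (2 * k) * (Real.log r + C₂)) = d at *
    field_simp
    linear_combination 4 * hcs
  · rw [hk2]
    generalize Real.cosh (1 / (2 * k) * (Real.log r + C₂)) = c at *
    generalize Real.sinh (1 / (2 * k) * (Real.log r + C₂)) = d at *
    field_simp
    linear_combination hcs

/-- With 1 − α = −k² the solution is s = −cot θ / k, and `energy` reads sin² + cos² = 1. -/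
lemma isProfileAt_sin {k : ℝ} (hk : k ≠ 0) (hk2 : 1 - α = -k ^ 2) (hα : α ≠ 0) (hC : C ≠ 0)
    (hr : r ≠ 0) (hc : Real.sin (1 / (2 * k) * (Real.log r + C₂)) ≠ 0) :
    IsProfileAt α C
      (fun r ↦ α / (4 * (1 - α) * C * r * Real.sin (1 / (2 * k) * (Real.log r + C₂)) ^ 2))
      (fun r ↦ -(Real.cos (1 / (2 * k) * (Real.log r + C₂)) /
        Real.sin (1 / (2 * k) * (Real.log r + C₂))) / k) r := by
  rw [hk2]
  have hθ := hasDerivAt_phase k C₂ hr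
  have hcs := Real.sin_sq_add_cos_sq (1 / (2 * k) * (Real.log r + C₂))
  have hdc := hθ.sin
  have hds := hθ.cos
  have hden : 4 * -k ^ 2 * C * r * Real.sin (1 / (2 * k) * (Real.log r + C₂)) ^ 2 ≠ 0 := by
    simp only [mul_neg, neg_mul, neg_ne_zero]
    positivity
  refine ⟨div_ne_zero hα hden, ?_, ?_, ?_⟩
  · convert! (hasDerivAt_const r α).fun_div
      (((hasDerivAt_id r).const_mul (4 * -k ^ 2 * C)).fun_mul (hdc.fun_pow 2)) hden using 1
    simp only [id]
    generalize Real.sin (1 / (2 * k) * (Real.log r + C₂)) = c at *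
    generalize Real.cos (1 / (2 * k) * (Real.log r + C₂)) = d at *
    field_simp
    ring
  · convert! ((hds.fun_div hdc hc).fun_neg.div_const k) using 1
    generalize Real.sin (1 / (2 * k) * (Real.log r + C₂)) = c at *
    generalize Real.cos (1 / (2 * k) * (Real.log r + C₂)) = d at *
    field_simp
    linear_combination -4 * hcs
  · rw [hk2]
    generalize Real.sin (1 / (2 * k) * (Real.log r + C₂)) = c at *
    generalize Real.cos (1 / (2 * k) * (Real.log r + C₂)) = d at *
    field_simp
    linear_combination hcs

/-- For C = 0 the slope s is constant and `energy` forces s² = 1/(1 − α); integrating (log(r v))' =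
s/r gives v = r^(s − 1), up to a constant factor. -/
lemma isProfileAt_rpow {β : ℝ} (hβ : (1 - α) * (β + 1) ^ 2 = 1) (hr : 0 < r) :
    IsProfileAt α 0 (fun r ↦ r ^ β) (fun _ ↦ β + 1) r where
  ne_zero := (Real.rpow_pos_of_pos hr β).ne'
  hasDerivAt := by
    convert! Real.hasDerivAt_rpow_const (p := β) (Or.inl hr.ne') using 1
    rw [Real.rpow_sub_one hr.ne']
    ring
  hasDerivAt_slope := by simpa using hasDerivAt_const r (β + 1)
  energy := by rw [hβ]; ring

/-- The zeros of the phase in the trigonometric profile. -/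
lemma sin_phase_ne_zero_iff {k : ℝ} (hk : k ≠ 0) (hr : 0 < r) :
    Real.sin (1 / (2 * k) * (Real.log r + C₂)) ≠ 0 ↔
      ∀ N : ℤ, r ≠ Real.exp (2 * (N : ℝ) * k * Real.pi - C₂) := by
  rw [Ne, Real.sin_eq_zero_iff, not_exists]
  refine forall_congr' fun N ↦ not_congr ?_
  constructor
  · intro h
    have : Real.log r = 2 * (N : ℝ) * k * Real.pi - C₂ := by
      field_simp at h
      linarith
    rw [← this, Real.exp_log hr]
  · rintro rfl
    rw [Real.log_exp]
    field_simp
    ring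

end Profiles

end

end HomogPair

theorem corollary3p14 {E : Type*} [NormedAddCommGroup E] [NormedSpace ℝ E] [FiniteDimensional ℝ E]
    {M : Type*} [TopologicalSpace M] [ChartedSpace E M] [IsManifold 𝓘(ℝ, E) ∞ M]
    (m : ℝ → M → M) (g : HomogPair.BilinField E M) (f : M → ℝ) (α : ℝ) (hα : α ≠ 1)
    (hgf : HomogPair.IsHomogeneousPair m g f α) (hflat : HomogPair.IsFlatOn g Set.univ) :
    (α < 1 →
      (∀ C C₂ : ℝ, 0 < α * C →
        let v : ℝ → ℝ := fun r ↦
          α / (4 * (1 - α) * C * r *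
            Real.cosh (1 / (2 * √(1 - α)) * (Real.log r + C₂)) ^ 2)
        let h := HomogPair.conformal v f (HomogPair.hatMetric g f α)
        HomogPair.IsPseudoRiemannianOn h Set.univ ∧
          HomogPair.HasConstSectionalCurvatureOn h Set.univ C) ∧
      (∀ β : ℝ, (β = -1 + 1 / √(1 - α) ∨ β = -1 - 1 / √(1 - α)) →
        let h := HomogPair.conformal (fun r ↦ r ^ β) f (HomogPair.hatMetric g f α)
        HomogPair.IsPseudoRiemannianOn h Set.univ ∧ HomogPair.IsFlatOn h Set.univ)) ∧
    (1 < α →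
      ∀ C C₂ : ℝ, C < 0 →
        let v : ℝ → ℝ := fun r ↦
          α / (4 * (1 - α) * C * r *
            Real.sin (1 / (2 * √(α - 1)) * (Real.log r + C₂)) ^ 2)
        let h := HomogPair.conformal v f (HomogPair.hatMetric g f α)
        let U : Set M :=
          (⋃ N : ℤ, f ⁻¹' {Real.exp (2 * (N : ℝ) * √(α - 1) * Real.pi - C₂)})ᶜ
        IsOpen U ∧ HomogPair.IsPseudoRiemannianOn h U ∧
          HomogPair.HasConstSectionalCurvatureOn h U C) := by
  have hα0 : α ≠ 0 := hgf.degree_ne_zero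
  refine ⟨fun hα1 ↦ ⟨fun C C₂ hC ↦ ?_, fun β hβ ↦ ?_⟩, fun hα1 C C₂ hC ↦ ?_⟩
  · have hk : √(1 - α) ≠ 0 := (Real.sqrt_pos.2 (sub_pos.2 hα1)).ne'
    have hk2 : 1 - α = √(1 - α) ^ 2 := (Real.sq_sqrt (sub_pos.2 hα1).le).symm
    have hC0 : C ≠ 0 := right_ne_zero_of_mul hC.ne'
    have h1 : 1 - α ≠ 0 := (sub_pos.2 hα1).ne'
    have hden (r : ℝ) (hr : r ≠ 0) : 4 * (1 - α) * C * r *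
        Real.cosh (1 / (2 * √(1 - α)) * (Real.log r + C₂)) ^ 2 ≠ 0 := by
      have := (Real.cosh_pos (1 / (2 * √(1 - α)) * (Real.log r + C₂))).ne'
      positivity
    refine ⟨hgf.isPseudoRiemannianOn_conformal hα (fun x _ ↦ ?_) fun x _ ↦ ?_,
      hgf.hasConstSectionalCurvatureOn_conformal hα hflat fun x _ ↦
        (lt_mem_nhds (hgf.pos x)).mono fun r hr ↦
          HomogPair.isProfileAt_cosh hk hk2 hα0 hC0 hr.ne'⟩
    · have hx := (hgf.pos x).ne'
      exact contDiffAt_const.div ((contDiffAt_const.mul contDiffAt_id).mul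
        (((HomogPair.contDiffAt_phase _ C₂ hx).cosh).pow 2)) (hden _ hx)
    · exact div_ne_zero hα0 (hden _ (hgf.pos x).ne')
  · have hk2 : √(1 - α) ^ 2 = 1 - α := Real.sq_sqrt (sub_pos.2 hα1).le
    have h1 : 1 - α ≠ 0 := (sub_pos.2 hα1).ne'
    have hβ2 : (1 - α) * (β + 1) ^ 2 = 1 := by
      -- Both signs give the same square, hence both roots of the energy equation for C = 0.
      have : (β + 1) ^ 2 = 1 / √(1 - α) ^ 2 := by
        rcases hβ with rfl | rfl <;> ring
      rw [this, hk2]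
      field_simp
    refine ⟨hgf.isPseudoRiemannianOn_conformal hα
      (fun x _ ↦ Real.contDiffAt_rpow_const_of_ne (hgf.pos x).ne')
      fun x _ ↦ (Real.rpow_pos_of_pos (hgf.pos x) β).ne',
      hgf.isFlatOn_conformal hα hflat fun x _ ↦
        (lt_mem_nhds (hgf.pos x)).mono fun r hr ↦ HomogPair.isProfileAt_rpow hβ2 hr⟩
  · have hk : √(α - 1) ≠ 0 := (Real.sqrt_pos.2 (sub_pos.2 hα1)).ne'
    have hk2 : 1 - α = -√(α - 1) ^ 2 := by rw [Real.sq_sqrt (sub_pos.2 hα1).le]; ring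
    have h1 : 1 - α ≠ 0 := (sub_neg.2 hα1).ne
    have hC0 : C ≠ 0 := hC.ne
    intro v h U
    -- The removed level sets of f are exactly where the sine in the denominator of v vanishes.
    have hU (x : M) : x ∈ U ↔ Real.sin (1 / (2 * √(α - 1)) * (Real.log (f x) + C₂)) ≠ 0 := by
      rw [HomogPair.sin_phase_ne_zero_iff hk (hgf.pos x)]
      simp [U]
    have hden (r : ℝ) (hr : r ≠ 0)
        (hs : Real.sin (1 / (2 * √(α - 1)) * (Real.log r + C₂)) ≠ 0) : 4 * (1 - α) * C * r *
        Real.sin (1 / (2 * √(α - 1)) * (Real.log r + C₂)) ^ 2 ≠ 0 := by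
      positivity
    refine ⟨?_, hgf.isPseudoRiemannianOn_conformal hα (fun x hx ↦ ?_) fun x hx ↦ ?_,
      hgf.hasConstSectionalCurvatureOn_conformal hα hflat fun x hx ↦
        -- The profile equations must hold near f x: positivity and nonvanishing of the sine are
        -- both open conditions.
        ((lt_mem_nhds (hgf.pos x)).and ((HomogPair.contDiffAt_phase (√(α - 1)) C₂
          (hgf.pos x).ne').sin.continuousAt.eventually_ne ((hU x).1 hx))).mono fun r hr ↦
            HomogPair.isProfileAt_sin hk hk2 hα0 hC0 hr.1.ne' hr.2⟩
    · have hUeq : U = {x | Real.sin (1 / (2 * √(α - 1)) * (Real.log (f x) + C₂)) ≠ 0} :=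
        Set.ext hU
      rw [hUeq]
      have hf : Continuous fun x ↦ Real.log (f x) :=
        hgf.smooth.continuous.log fun x ↦ (hgf.pos x).ne'
      exact isOpen_ne_fun (by fun_prop) continuous_const
    · have hx0 := (hgf.pos x).ne'
      exact contDiffAt_const.div ((contDiffAt_const.mul contDiffAt_id).mul
        (((HomogPair.contDiffAt_phase _ C₂ hx0).sin).pow 2)) (hden _ hx0 ((hU x).1 hx))
    · exact div_ne_zero hα0 (hden _ (hgf.pos x).ne' ((hU x).1 hx))
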